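/- Let $p$ be a prime and let $V$ be a scheme of finite type over $\mathbb{Z}_p$. Suppose that for every $\mathbb{Z}_p$-valued point $x\colon \operatorname{Spec}\mathbb{Z}_p\to V$ (over $\mathbb{Z}_p$), $V$ is smooth over $\mathbb{Z}_p$ at $x(\eta)$, where $\eta$ is the generic point of $\operatorname{Spec}\mathbb{Z}_p$. Let $\operatorname{T}(V)$ be the (possibly empty) tree whose nodes at depth $\lambda\ge 0$ are the elements of the image of $V(\mathbb{Z}_p)\to V(\mathbb{Z}/p^\lambda\mathbb{Z})$, with tree structure given by the maps $V(\mathbb{Z}/p^{\lambda+1}\mathbb{Z})\to V(\mathbb{Z}/p^{\lambda}\mathbb{Z})$; let $\operatorname{T}(\mathbb{Z}_p^d)$ be the tree with set of nodes $(\mathbb{Z}/p^\lambda\mathbb{Z})^d$ at depth $\lambda$, with the reduction maps. Write $\dim V$ for the dimension of the generic fibre of $V$ (which is at most the Krull dimension of $V$, and is $-\infty$ if the generic fibre is empty). Then: (1) $\operatorname{T}(V)$ is isomorphic to a tree obtained from a finite (possibly empty) tree by attaching to each leaf $w$ a copy of $\operatorname{T}(\mathbb{Z}_p^{d_w})$ for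 some integer $d_w$ with $0\le d_w\le\dim V$ (depending on $w$). (2) In particular, $\operatorname{T}(V)$ is a tree of level $n$ for every integer $n\ge 0$ with $n\ge\dim V$; so it is of level $\dim V$ if the generic fibre is non-empty. Here trees of level $d$ are defined recursively, with parameters $\kappa$ in a set $M\subset\mathbb{Z}^m$ definable in $(\mathbb{Z},0,+,<)$; a family of trees $(\mathcal T(\kappa))_{\kappa\in M}$ is of level $d$ if each $\mathcal T(\kappa)$ is isomorphic to the tree constructed as follows from a datum not depending on $\kappa$. An (unparametrized) tree is of level $d$ if it is so as a family over the one-point set $M=\mathbb{Z}^0$. A function on $M$ is called linear if it has the form $\kappa\mapsto a_1\kappa_1+\dots+a_m\kappa_m+b$ with $a_i,b\in\mathbb{Q}$. - Level $0$: a datum is a finite (possibly empty) tree, whose nodes are called joints and whose edges are called bones, and for each bone a length, which is either a linear function $M\to\mathbb{Z}_{>0}$ or the constant $\infty$, the latter only for bones whose lower end is a leaf. The lower ends of bones of infinite length are called virtual joints, the other joints are real. The tree for $\kappa$ is obtained by replacing every bone by a path of the given length (by an infinite path in place of the bone and its virtual lower end if the length is $\infty$). The depth of a real joint is its depth in this tree;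 virtual joints have depth $\infty$. - A side branch of level $d$ over $M$ is given by a non-empty finite tree and, for each of its leaves $w$, a family $\mathcal T_w$ of non-empty trees over $M$ of level $d$; for $\kappa\in M$ it is the tree obtained by attaching $\operatorname{T}(\mathbb{Z}_p)\times\mathcal T_w(\kappa)$ to each leaf $w$ (products are taken depth by depth). - Level $d+1$: a datum is an integer $\rho>0$; a level $0$ datum over $M$ in which every finite bone length is constant modulo $\rho$; for each real joint a side branch of level $d$ over $M$; and for each bone $e$ and each class $c\in\mathbb{Z}/\rho\mathbb{Z}$ a side branch of level $d$ over the set of all $(\kappa,\lambda)\in M\times\mathbb{Z}$ such that $\lambda$ lies in $c$ and strictly between the depths (for $\kappa$) of the two ends of $e$. The tree for $\kappa$ is obtained from the level $0$ tree for $\kappa$ by attaching to each real joint its side branch for $\kappa$, and to each further node, lying on the bone $e$ at depth $\lambda$ in the class $c$, the side branch belonging to $e$ and $c$ for the parameter $(\kappa,\lambda)$. -/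

import Mathlib

open CategoryTheory AlgebraicGeometry

noncomputable section

namespace PadicTrees

/-! ### Trees -/

/-- A (possibly empty) rooted tree: a set of nodes with an is-child-of relation, `IsChild w v`
meaning that `w` is a child of `v`. Every node has a finite depth; there is at most one node of
depth zero (the root); every other node has exactly one parent. The depth function is determined
by the child relation. -/
structure Tree where
  Node : Type
  IsChild : Node → Node → Prop
  depth : Node → ℕ
  depth_of_isChild : ∀ {w v}, IsChild w v → depth w = depth v + 1
  root_unique : ∀ {v w}, depth v = 0 → depth w = 0 → v = w
  exists_parent : ∀ {w}, depth w ≠ 0 → ∃ v, IsChild w v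
  parent_unique : ∀ {w v v'}, IsChild w v → IsChild w v' → v = v'

namespace Tree

/-- A leaf is a node without children. -/
def IsLeaf (T : Tree) (v : T.Node) : Prop := ∀ w, ¬ T.IsChild w v

/-- The type of leaves of a tree. -/
def Leaf (T : Tree) : Type := {v : T.Node // T.IsLeaf v}

/-- Two trees are isomorphic if there is a bijection of the nodes preserving the child relation. -/
def Isomorphic (S T : Tree) : Prop :=
  ∃ e : S.Node ≃ T.Node, ∀ w v, S.IsChild w v ↔ T.IsChild (e w) (e v)

/-- The edges of a tree. -/
@[ext]
structure Edge (T : Tree) where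
  upper : T.Node
  lower : T.Node
  isChild : T.IsChild lower upper

/-- The edge ending in a given node different from the root. -/
def edgeTo (T : Tree) (v : T.Node) (h : T.depth v ≠ 0) : T.Edge :=
  ⟨(T.exists_parent h).choose, v, (T.exists_parent h).choose_spec⟩

theorem depth_lower (T : Tree) (e : T.Edge) : T.depth e.lower = T.depth e.upper + 1 :=
  T.depth_of_isChild e.isChild

theorem edge_eq (T : Tree) {e e' : T.Edge} (h : e.lower = e'.lower) : e = e' := by
  obtain ⟨u, l, c⟩ := e
  obtain ⟨u', l', c'⟩ := e'
  obtain rfl : l = l' := h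
  obtain rfl := T.parent_unique c c'
  rfl

/-- The product of two trees, defined layerwise. -/
def prod (S T : Tree) : Tree where
  Node := {x : S.Node × T.Node // S.depth x.1 = T.depth x.2}
  IsChild w v := S.IsChild w.1.1 v.1.1 ∧ T.IsChild w.1.2 v.1.2
  depth x := S.depth x.1.1
  depth_of_isChild h := S.depth_of_isChild h.1
  root_unique {v w} hv hw :=
    Subtype.ext (Prod.ext (S.root_unique hv hw)
      (T.root_unique (v.2 ▸ hv) (w.2 ▸ hw)))
  exists_parent {w} h := by
    obtain ⟨a, ha⟩ := S.exists_parent h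
    obtain ⟨b, hb⟩ := T.exists_parent (w.2 ▸ h)
    refine ⟨⟨(a, b), ?_⟩, ha, hb⟩
    have h1 := S.depth_of_isChild ha
    have h2 := T.depth_of_isChild hb
    have h3 := w.2
    dsimp only
    omega
  parent_unique h h' :=
    Subtype.ext (Prod.ext (S.parent_unique h.1 h'.1) (T.parent_unique h.2 h'.2))

/-- The child relation of the tree obtained by attaching, for each `i`, the tree `B i` to the
node `pos i` of `T`. -/
inductive AttachChild (T : Tree) {ι : Type} (pos : ι → T.Node) (B : ι → Tree) :
    T.Node ⊕ (Σ i, {b : (B i).Node // (B i).depth b ≠ 0}) →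
    T.Node ⊕ (Σ i, {b : (B i).Node // (B i).depth b ≠ 0}) → Prop
  | base {w v : T.Node} : T.IsChild w v → AttachChild T pos B (.inl w) (.inl v)
  | top (i : ι) (b : {b : (B i).Node // (B i).depth b ≠ 0}) :
      (B i).depth b.1 = 1 → AttachChild T pos B (.inr ⟨i, b⟩) (.inl (pos i))
  | branch (i : ι) (b c : {b : (B i).Node // (B i).depth b ≠ 0}) :
      (B i).IsChild b.1 c.1 → AttachChild T pos B (.inr ⟨i, b⟩) (.inr ⟨i, c⟩)

/-- The tree obtained from `T` by attaching, for each `i`, the (non-empty) tree `B i` to the node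
`pos i` of `T`: the disjoint union, with the root of `B i` identified with `pos i`. (So the new
nodes are the nodes of the `B i` other than the root.) -/
def attach (T : Tree) {ι : Type} (pos : ι → T.Node) (B : ι → Tree) : Tree where
  Node := T.Node ⊕ (Σ i, {b : (B i).Node // (B i).depth b ≠ 0})
  IsChild := AttachChild T pos B
  depth := Sum.elim T.depth (fun x => T.depth (pos x.1) + (B x.1).depth x.2.1)
  depth_of_isChild h := by
    cases h with
    | base h => exact T.depth_of_isChild h
    | top i b h => simp [h]
    | branch i b c h =>
      have := (B i).depth_of_isChild h
      simp only [Sum.elim_inr]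
      omega
  root_unique {v w} hv hw := by
    rcases v with v | ⟨i, b⟩
    · rcases w with w | ⟨j, c⟩
      · exact congrArg Sum.inl (T.root_unique hv hw)
      · exact absurd hw (by have := c.2; simp only [Sum.elim_inr]; omega)
    · exact absurd hv (by have := b.2; simp only [Sum.elim_inr]; omega)
  exists_parent {w} hw := by
    rcases w with w | ⟨i, b⟩
    · obtain ⟨v, hv⟩ := T.exists_parent (w := w) hw
      exact ⟨.inl v, .base hv⟩
    · by_cases h1 : (B i).depth b.1 = 1
      · exact ⟨.inl (pos i), .top i b h1⟩
      · obtain ⟨c, hc⟩ := (B i).exists_parent b.2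
        have h2 := (B i).depth_of_isChild hc
        have h3 := b.2
        exact ⟨.inr ⟨i, ⟨c, by omega⟩⟩, .branch i b ⟨c, by omega⟩ hc⟩
  parent_unique {w v v'} h h' := by
    cases h with
    | base h =>
      cases h' with
      | base h' => exact congrArg Sum.inl (T.parent_unique h h')
    | top i b h =>
      cases h' with
      | top _ _ h' => rfl
      | branch _ _ c h' =>
        have h2 := (B i).depth_of_isChild h'
        have h3 := c.2
        omega
    | branch i b c h =>
      cases h' with
      | top _ _ h' =>
        have h2 := (B i).depth_of_isChild h
        have h3 := c.2
        omega
      | branch _ _ c' h' =>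
        have : c = c' := Subtype.ext ((B i).parent_unique h h')
        rw [this]

/-- The tree obtained from `T` by attaching a tree to each leaf of `T`. -/
def attachLeaves (T : Tree) (B : T.Leaf → Tree) : Tree :=
  T.attach (fun w : T.Leaf => w.1) B

/-- The tree whose set of nodes at depth `n` is `L n`, with the tree structure given by the maps
`res n : L (n + 1) → L n`. -/
def ofTower (L : ℕ → Type) (res : ∀ n, L (n + 1) → L n) (h0 : Subsingleton (L 0)) : Tree where
  Node := Σ n, L n
  IsChild w v := ∃ (n : ℕ) (y : L (n + 1)), w = ⟨n + 1, y⟩ ∧ v = ⟨n, res n y⟩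
  depth := Sigma.fst
  depth_of_isChild := by
    rintro _ _ ⟨n, y, rfl, rfl⟩
    rfl
  root_unique := by
    rintro ⟨n, y⟩ ⟨m, z⟩ hn hm
    obtain rfl : n = 0 := hn
    obtain rfl : m = 0 := hm
    rw [Subsingleton.elim y z]
  exists_parent := by
    rintro ⟨n, y⟩ hn
    obtain ⟨m, rfl⟩ := Nat.exists_eq_succ_of_ne_zero hn
    exact ⟨_, m, y, rfl, rfl⟩
  parent_unique := by
    rintro _ _ _ ⟨n, y, rfl, rfl⟩ ⟨n', y', h, rfl⟩
    obtain rfl : n = n' := by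
      have := congrArg Sigma.fst h
      simpa using this
    obtain rfl : y = y' := by simpa using h
    rfl

end Tree

/-! ### The trees `T(ℤ_p^d)` and `T(V)` -/

/-- The tree `T(ℤ_p^d)`: the nodes at depth `n` are the elements of `(ℤ/p^n)^d`, with the
reduction maps. -/
def padicTree (p : ℕ) (d : ℕ) : Tree :=
  Tree.ofTower (fun n => Fin d → ZMod (p ^ n))
    (fun n x i => ZMod.castHom (pow_dvd_pow p n.le_succ) (ZMod (p ^ n)) (x i))
    (by
      have : Subsingleton (ZMod (p ^ 0)) := by
        rw [pow_zero]; infer_instance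
      infer_instance)

section Scheme

variable (p : ℕ) [Fact p.Prime] {V : Scheme.{0}} (f : V ⟶ Spec (.of ℤ_[p]))

/-- The `ℤ_p`-valued points of the `ℤ_p`-scheme `V` with structure morphism `f`. -/
def PadicPoint : Type := {x : Spec (.of ℤ_[p]) ⟶ V // x ≫ f = 𝟙 _}

/-- The reduction `V(ℤ_p) → V(ℤ/p^n)`. -/
def reduction (n : ℕ) (x : PadicPoint p f) : Spec (.of (ZMod (p ^ n))) ⟶ V :=
  Spec.map (CommRingCat.ofHom (PadicInt.toZModPow n)) ≫ x.1

/-- The map `V(ℤ/p^(n+1)) → V(ℤ/p^n)`. -/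
def reductionStep (n : ℕ) (y : Spec (.of (ZMod (p ^ (n + 1)))) ⟶ V) :
    Spec (.of (ZMod (p ^ n))) ⟶ V :=
  Spec.map (CommRingCat.ofHom (ZMod.castHom (pow_dvd_pow p n.le_succ) (ZMod (p ^ n)))) ≫ y

theorem reductionStep_reduction (n : ℕ) (x : PadicPoint p f) :
    reductionStep p n (reduction p f (n + 1) x) = reduction p f n x := by
  unfold reductionStep reduction
  rw [← Category.assoc, ← Spec.map_comp, ← CommRingCat.ofHom_comp,
    PadicInt.zmod_cast_comp_toZModPow n (n + 1) n.le_succ]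

/-- The tree `T(V)` of a scheme `V` over `ℤ_p`: the nodes at depth `n` are the elements of the
image of `V(ℤ_p) → V(ℤ/p^n)`, and the tree structure is given by `V(ℤ/p^(n+1)) → V(ℤ/p^n)`. -/
def schemeTree : Tree :=
  Tree.ofTower (fun n => Set.range (reduction p f n))
    (fun n y => ⟨reductionStep p n y.1, by
      obtain ⟨_, x, rfl⟩ := y
      exact ⟨x, (reductionStep_reduction p f n x).symm⟩⟩)
    (by
      have : Subsingleton (ZMod (p ^ 0)) := by
        rw [pow_zero]; infer_instance
      have : Subsingleton (CommRingCat.of (ZMod (p ^ 0))) := this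
      have : IsEmpty (Spec (.of (ZMod (p ^ 0)))) :=
        inferInstanceAs (IsEmpty (PrimeSpectrum (ZMod (p ^ 0))))
      exact ⟨fun a b => Subtype.ext (isInitialOfIsEmpty.hom_ext _ _)⟩)

/-- The generic point of `Spec ℤ_p`. -/
def genericPt : Spec (.of ℤ_[p]) := (⊥ : PrimeSpectrum ℤ_[p])

/-- The scheme `V` is smooth (over `ℤ_p`) at the point `v`: some open neighbourhood of `v` in `V`
is smooth over `ℤ_p`. At points of the generic fibre this is the same as smoothness of the generic
fibre over `ℚ_p`, the generic fibre being open in `V`. -/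
def SmoothAtPoint (v : V) : Prop := ∃ U : V.Opens, v ∈ U ∧ Smooth (U.ι ≫ f)

/-- The dimension of the generic fibre of `V` (it is `⊥`, i.e. `-∞`, if that fibre is empty). -/
def genericDim : WithBot ℕ∞ := topologicalKrullDim (f.fiber (genericPt p))

/-- The dimension of the generic fibre is at most the Krull dimension of the scheme `V`. -/
theorem genericDim_le : genericDim p f ≤ topologicalKrullDim V :=
  (f.fiberι (genericPt p)).isEmbedding.isInducing.topologicalKrullDim_le

end Scheme

/-! ### Trees of level `d`

The value group `Γ` is `ℤ`; parameters run over definable subsets of `ℤ^m`. -/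

/-- The symbol `≤` is interpreted in `ℤ` by the usual order. -/
instance orderStructureInt : FirstOrder.Language.order.Structure ℤ :=
  FirstOrder.Language.orderStructure ℤ

/-- Subsets of `ℤ^m` definable (with parameters) in the ordered group `(ℤ, 0, +, <)`. -/
def DefinableSet {m : ℕ} (M : Set (Fin m → ℤ)) : Prop :=
  Set.Definable Set.univ
    (FirstOrder.Language.sum FirstOrder.Language.presburger FirstOrder.Language.order) M

/-- A function `ℓ` on `M ⊆ ℤ^m` is linear if it is of the form
`κ ↦ a₁ κ₁ + ⋯ + a_m κ_m + b` for some rational numbers `a_i`, `b`. -/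
def IsLinearOn {m : ℕ} {M : Set (Fin m → ℤ)} (ℓ : M → ℕ) : Prop :=
  ∃ (a : Fin m → ℚ) (b : ℚ), ∀ κ : M, (ℓ κ : ℚ) = ∑ i, a i * (κ.1 i : ℚ) + b

/-- A datum for a level `0` tree on `M`: a finite tree (its nodes are the joints, its edges the
bones), and for each bone a length which is either a linear function from `M` to the positive
integers, or (only for bones ending in a leaf) the constant `∞`, here `⊤`. -/
structure SkeletonDatum {m : ℕ} (M : Set (Fin m → ℤ)) where
  skel : Tree
  finite : Finite skel.Node
  length : skel.Edge → WithTop (M → ℕ)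
  linear : ∀ (e : skel.Edge) (ℓ : M → ℕ), length e = (ℓ : WithTop (M → ℕ)) → IsLinearOn ℓ
  pos : ∀ (e : skel.Edge) (ℓ : M → ℕ), length e = (ℓ : WithTop (M → ℕ)) → ∀ κ, 0 < ℓ κ
  leaf_of_length : ∀ e : skel.Edge, length e = ⊤ → skel.IsLeaf e.lower

namespace SkeletonDatum

variable {m : ℕ} {M : Set (Fin m → ℤ)} (D : SkeletonDatum M)

/-- The length of a bone for the parameter `κ`. -/
def lengthAt (κ : M) (e : D.skel.Edge) : ℕ∞ :=
  (D.length e).map (fun ℓ => ℓ κ)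

/-- A virtual joint is one at the end of a bone of infinite length; the others are real. -/
def IsVirtual (v : D.skel.Node) : Prop := ∃ e : D.skel.Edge, e.lower = v ∧ D.length e = ⊤

/-- The type of real joints. -/
def RealJoint : Type := {v : D.skel.Node // ¬ D.IsVirtual v}

/-- The depth of a joint for the parameter `κ`: the sum of the lengths of the bones above it. -/
def jointDepth (κ : M) (v : D.skel.Node) : ℕ∞ :=
  open Classical in
  if h : D.skel.depth v = 0 then 0
  else jointDepth κ (D.skel.edgeTo v h).upper + D.lengthAt κ (D.skel.edgeTo v h)
termination_by D.skel.depth v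
decreasing_by
  have h1 := D.skel.depth_lower (D.skel.edgeTo v h)
  have h2 : (D.skel.edgeTo v h).lower = v := rfl
  rw [h2] at h1
  omega

theorem jointDepth_lower (κ : M) (e : D.skel.Edge) :
    D.jointDepth κ e.lower = D.jointDepth κ e.upper + D.lengthAt κ e := by
  have h : D.skel.depth e.lower ≠ 0 := by rw [D.skel.depth_lower]; omega
  have he : D.skel.edgeTo e.lower h = e := D.skel.edge_eq rfl
  rw [jointDepth, dif_neg h, he]

theorem lengthAt_ne_zero (κ : M) (e : D.skel.Edge) : D.lengthAt κ e ≠ 0 := by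
  unfold lengthAt
  cases h : D.length e with
  | top => exact ENat.top_ne_zero
  | coe ℓ =>
    have := D.pos e ℓ h κ
    change ((ℓ κ : ℕ) : ℕ∞) ≠ 0
    exact_mod_cast this.ne'

theorem lengthAt_ne_top (κ : M) (e : D.skel.Edge) (h : ¬ D.IsVirtual e.lower) :
    D.lengthAt κ e ≠ ⊤ := by
  unfold lengthAt
  cases h' : D.length e with
  | top => exact absurd ⟨e, rfl, h'⟩ h
  | coe ℓ => exact ENat.natCast_ne_top (ℓ κ)

theorem not_isVirtual_upper (e : D.skel.Edge) : ¬ D.IsVirtual e.upper := by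
  rintro ⟨e', h, h'⟩
  have := D.leaf_of_length e' h'
  rw [h] at this
  exact this _ e.isChild

theorem jointDepth_ne_top (κ : M) (v : D.skel.Node) (hv : ¬ D.IsVirtual v) :
    D.jointDepth κ v ≠ ⊤ := by
  induction hn : D.skel.depth v generalizing v with
  | zero => rw [jointDepth, dif_pos hn]; simp
  | succ n ih =>
    have h : D.skel.depth v ≠ 0 := by omega
    rw [jointDepth, dif_neg h]
    have h1 := D.skel.depth_lower (D.skel.edgeTo v h)
    have h2 : (D.skel.edgeTo v h).lower = v := rfl
    rw [h2] at h1
    exact WithTop.add_ne_top.2 ⟨ih _ (D.not_isVirtual_upper _) (by omega),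
      D.lengthAt_ne_top κ _ (by rwa [h2])⟩

/-- The nodes of the level `0` tree for the parameter `κ`: the real joints, and `length - 1` many
(infinitely many for infinite length) further nodes for each bone, numbered by the distance to the
upper end of the bone. -/
def TreeNode (κ : M) : Type :=
  D.RealJoint ⊕ (Σ e : D.skel.Edge, {i : ℕ // 0 < i ∧ (i : ℕ∞) < D.lengthAt κ e})

/-- `D.OnBone κ e i x` means that `x` is the node at distance `i` from the upper end on the path
consisting of the bone `e` and its end points. -/
def OnBone (κ : M) (e : D.skel.Edge) (i : ℕ) : D.TreeNode κ → Prop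
  | .inl v => (v.1 = e.upper ∧ i = 0) ∨ (v.1 = e.lower ∧ (i : ℕ∞) = D.lengthAt κ e)
  | .inr b => b.1 = e ∧ b.2.1 = i

/-- The depth of the nodes of the level `0` tree. -/
def nodeDepth (κ : M) : D.TreeNode κ → ℕ
  | .inl v => (D.jointDepth κ v.1).toNat
  | .inr b => (D.jointDepth κ b.1.upper).toNat + b.2.1

theorem nodeDepth_of_onBone {κ : M} {e : D.skel.Edge} {i : ℕ} {x : D.TreeNode κ}
    (h : D.OnBone κ e i x) : D.nodeDepth κ x = (D.jointDepth κ e.upper).toNat + i := by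
  rcases x with v | b
  · rcases h with ⟨h, rfl⟩ | ⟨h, h'⟩
    · simp [nodeDepth, h]
    · have h1 := D.jointDepth_ne_top κ _ (D.not_isVirtual_upper e)
      change (D.jointDepth κ v.1).toNat = _
      rw [h, D.jointDepth_lower, ← h', ENat.toNat_add h1 (ENat.natCast_ne_top i), ENat.toNat_natCast]
  · obtain ⟨rfl, rfl⟩ := h
    rfl

theorem exists_onBone (κ : M) (e : D.skel.Edge) (i : ℕ) (h : (i : ℕ∞) < D.lengthAt κ e) :
    ∃ x, D.OnBone κ e i x := by
  rcases Nat.eq_zero_or_pos i with rfl | hi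
  · exact ⟨.inl ⟨e.upper, D.not_isVirtual_upper e⟩, .inl ⟨rfl, rfl⟩⟩
  · exact ⟨.inr ⟨e, i, hi, h⟩, rfl, rfl⟩

theorem onBone_unique {κ : M} {e : D.skel.Edge} {i : ℕ} {x y : D.TreeNode κ}
    (hx : D.OnBone κ e i x) (hy : D.OnBone κ e i y) : x = y := by
  have h0 := D.lengthAt_ne_zero κ e
  rcases x with v | ⟨e1, b⟩ <;> rcases y with w | ⟨e2, c⟩
  · rcases hx with ⟨h, h'⟩ | ⟨h, h'⟩ <;> rcases hy with ⟨k, k'⟩ | ⟨k, k'⟩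
    · exact congrArg Sum.inl (Subtype.ext (h.trans k.symm))
    · subst h'; exact absurd k'.symm (by simpa using h0)
    · subst k'; exact absurd h'.symm (by simpa using h0)
    · exact congrArg Sum.inl (Subtype.ext (h.trans k.symm))
  · obtain ⟨h1, h2⟩ : e2 = e ∧ c.1 = i := hy
    subst h1
    have := c.2.1
    have hlt := c.2.2
    rw [h2] at hlt
    rcases hx with ⟨h, h'⟩ | ⟨h, h'⟩
    · omega
    · exact absurd h' hlt.ne
  · obtain ⟨h1, h2⟩ : e1 = e ∧ b.1 = i := hx
    subst h1
    have := b.2.1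
    have hlt := b.2.2
    rw [h2] at hlt
    rcases hy with ⟨h, h'⟩ | ⟨h, h'⟩
    · omega
    · exact absurd h' hlt.ne
  · obtain ⟨h1, h2⟩ : e1 = e ∧ b.1 = i := hx
    obtain ⟨k1, k2⟩ : e2 = e ∧ c.1 = i := hy
    subst h1
    subst k1
    have : b = c := Subtype.ext (h2.trans k2.symm)
    rw [this]

theorem onBone_succ_unique {κ : M} {e e' : D.skel.Edge} {i i' : ℕ} {x : D.TreeNode κ}
    (h : D.OnBone κ e (i + 1) x) (h' : D.OnBone κ e' (i' + 1) x) : e = e' ∧ i = i' := by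
  have key : e = e' := by
    rcases x with v | b
    · rcases h with ⟨_, h⟩ | ⟨h, _⟩
      · omega
      · rcases h' with ⟨_, h'⟩ | ⟨h', _⟩
        · omega
        · exact D.skel.edge_eq (h.symm.trans h')
    · exact h.1.symm.trans h'.1
  subst key
  have h1 := D.nodeDepth_of_onBone h
  have h2 := D.nodeDepth_of_onBone h'
  exact ⟨rfl, by omega⟩

theorem depth_eq_zero_of_jointDepth {κ : M} {v : D.skel.Node} (h : D.jointDepth κ v = 0) :
    D.skel.depth v = 0 := by
  by_contra hv
  rw [jointDepth, dif_neg hv] at h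
  exact D.lengthAt_ne_zero κ _ (add_eq_zero.1 h).2

/-- The level `0` tree for the parameter `κ`: each bone of the skeleton is replaced by a path of
the length of the bone. -/
def tree (κ : M) : Tree where
  Node := D.TreeNode κ
  IsChild w v := ∃ e i, D.OnBone κ e i v ∧ D.OnBone κ e (i + 1) w
  depth := D.nodeDepth κ
  depth_of_isChild := by
    rintro w v ⟨e, i, hv, hw⟩
    rw [D.nodeDepth_of_onBone hv, D.nodeDepth_of_onBone hw]
    omega
  root_unique {v w} hv hw := by
    have key : ∀ x : D.TreeNode κ, D.nodeDepth κ x = 0 →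
        ∃ v : D.RealJoint, x = .inl v ∧ D.skel.depth v.1 = 0 := by
      rintro (v | b) h
      · refine ⟨v, rfl, D.depth_eq_zero_of_jointDepth (κ := κ) ?_⟩
        rcases (ENat.toNat_eq_zero.1 h) with h | h
        · exact h
        · exact absurd h (D.jointDepth_ne_top κ _ v.2)
      · have := b.2.2.1
        change _ + _ = _ at h
        omega
    obtain ⟨v, rfl, hv'⟩ := key v hv
    obtain ⟨w, rfl, hw'⟩ := key w hw
    exact congrArg Sum.inl (Subtype.ext (D.skel.root_unique hv' hw'))
  exists_parent {w} hw := by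
    have key : ∃ e i, D.OnBone κ e (i + 1) w ∧ (i : ℕ∞) < D.lengthAt κ e := by
      rcases w with v | ⟨e, b⟩
      · have h : D.skel.depth v.1 ≠ 0 := by
          intro h
          apply hw
          change (D.jointDepth κ v.1).toNat = 0
          rw [jointDepth, dif_pos h]
          rfl
        have hl : (D.skel.edgeTo v.1 h).lower = v.1 := rfl
        have h1 := D.lengthAt_ne_top κ (D.skel.edgeTo v.1 h) (by rw [hl]; exact v.2)
        have h2 := D.lengthAt_ne_zero κ (D.skel.edgeTo v.1 h)
        obtain ⟨k, hk⟩ := ENat.ne_top_iff_exists.1 h1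
        obtain ⟨j, rfl⟩ : ∃ j, k = j + 1 := by
          refine Nat.exists_eq_succ_of_ne_zero ?_
          rintro rfl
          exact h2 (by simpa using hk.symm)
        refine ⟨D.skel.edgeTo v.1 h, j, .inr ⟨rfl, hk⟩, ?_⟩
        rw [← hk]
        exact_mod_cast Nat.lt_succ_self j
      · obtain ⟨j, hj⟩ := Nat.exists_eq_succ_of_ne_zero b.2.1.ne'
        refine ⟨e, j, ⟨rfl, hj⟩, lt_of_le_of_lt ?_ b.2.2⟩
        exact_mod_cast (by omega : j ≤ b.1)
    obtain ⟨e, i, h, hi⟩ := key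
    obtain ⟨v, hv⟩ := D.exists_onBone κ e i hi
    exact ⟨v, e, i, hv, h⟩
  parent_unique := by
    rintro w v v' ⟨e, i, hv, hw⟩ ⟨e', i', hv', hw'⟩
    obtain ⟨rfl, rfl⟩ := D.onBone_succ_unique hw hw'
    exact D.onBone_unique hv hv'

/-- The set of pairs `(κ, n)` such that `n` is the depth, for the parameter `κ`, of a node strictly
inside the bone `e`, and such that `n` lies in the congruence class `c` modulo `ρ`. -/
def boneParams (e : D.skel.Edge) (ρ : ℕ) (c : ZMod ρ) : Set (Fin (m + 1) → ℤ) :=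
  {x | ∃ (h : (Fin.init x : Fin m → ℤ) ∈ M) (n : ℕ), x (Fin.last m) = n ∧ (n : ZMod ρ) = c ∧
    D.jointDepth ⟨Fin.init x, h⟩ e.upper < n ∧ (n : ℕ∞) < D.jointDepth ⟨Fin.init x, h⟩ e.lower}

theorem snoc_mem_boneParams (κ : M) (ρ : ℕ)
    (b : Σ e : D.skel.Edge, {i : ℕ // 0 < i ∧ (i : ℕ∞) < D.lengthAt κ e}) :
    (Fin.snoc (α := fun _ => ℤ) κ.1 (D.nodeDepth κ (.inr b) : ℤ) : Fin (m + 1) → ℤ) ∈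
      D.boneParams b.1 ρ (D.nodeDepth κ (.inr b) : ZMod ρ) := by
  obtain ⟨e, i, hi, hi'⟩ := b
  have hκ : (⟨Fin.init (Fin.snoc (α := fun _ => ℤ) κ.1 (D.nodeDepth κ (.inr ⟨e, i, hi, hi'⟩) : ℤ)),
      by rw [Fin.init_snoc]; exact κ.2⟩ : M) = κ := by
    apply Subtype.ext
    exact Fin.init_snoc (α := fun _ => ℤ) _ _
  refine ⟨by rw [Fin.init_snoc]; exact κ.2, D.nodeDepth κ (.inr ⟨e, i, hi, hi'⟩),
    Fin.snoc_last _ _, rfl, ?_, ?_⟩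
  all_goals
    rw [hκ]
    have h1 := D.jointDepth_ne_top κ _ (D.not_isVirtual_upper e)
    obtain ⟨k, hk⟩ := ENat.ne_top_iff_exists.1 h1
    have h2 : D.nodeDepth κ (.inr ⟨e, i, hi, hi'⟩) = k + i := by
      change (D.jointDepth κ e.upper).toNat + i = _
      rw [← hk, ENat.toNat_natCast]
    rw [h2]
  · rw [← hk]
    exact_mod_cast (by omega : k < k + i)
  · rw [D.jointDepth_lower, ← hk, Nat.cast_add]
    exact ENat.add_lt_add_iff_left (ENat.natCast_ne_top k) |>.2 hi'

end SkeletonDatum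

/-- A datum for a side branch on `M`: a non-empty finite tree, and for each of its leaves a
parametrized non-empty tree. -/
structure SideBranchDatum {m : ℕ} (M : Set (Fin m → ℤ)) where
  fin : Tree
  finite : Finite fin.Node
  nonempty : Nonempty fin.Node
  side : fin.Leaf → M → Tree
  side_nonempty : ∀ w κ, Nonempty (side w κ).Node

/-- The side branch for the parameter `κ`: to each leaf `w` of the finite tree,
`T(ℤ_p) × T_w(κ)` is attached. -/
def SideBranchDatum.tree (p : ℕ) {m : ℕ} {M : Set (Fin m → ℤ)} (S : SideBranchDatum M) (κ : M) :
    Tree :=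
  S.fin.attachLeaves (fun w => (padicTree p 1).prod (S.side w κ))

/-- A datum for a tree with a skeleton and side branches: a positive integer `ρ`, a skeleton whose
bones have lengths which are constant modulo `ρ` (or `∞`), a side branch for each real joint, and a
side branch for each bone and each congruence class modulo `ρ`, the latter being parametrized by
`κ` and the depth of the node to which the side branch is attached. -/
structure LevelDatum {m : ℕ} (M : Set (Fin m → ℤ)) where
  ρ : ℕ
  ρ_pos : 0 < ρ
  skeleton : SkeletonDatum M
  length_mod : ∀ (e : skeleton.skel.Edge) (ℓ : M → ℕ),
    skeleton.length e = (ℓ : WithTop (M → ℕ)) → ∀ κ κ', ℓ κ ≡ ℓ κ' [MOD ρ]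
  jointBranch : skeleton.RealJoint → SideBranchDatum M
  boneBranch : ∀ (e : skeleton.skel.Edge) (c : ZMod ρ),
    SideBranchDatum (skeleton.boneParams e ρ c)

namespace LevelDatum

variable (p : ℕ) {m : ℕ} {M : Set (Fin m → ℤ)} (D : LevelDatum M)

/-- The side branch attached to a given node of the skeleton for the parameter `κ`. -/
def branchAt (κ : M) : D.skeleton.TreeNode κ → Tree
  | .inl v => (D.jointBranch v).tree p κ
  | .inr b => (D.boneBranch b.1 (D.skeleton.nodeDepth κ (.inr b) : ZMod D.ρ)).tree p
      ⟨_, D.skeleton.snoc_mem_boneParams κ D.ρ b⟩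

/-- The tree for the parameter `κ`: to every node of the skeleton, the side branch is attached. -/
def tree (κ : M) : Tree :=
  (D.skeleton.tree κ).attach (fun v : D.skeleton.TreeNode κ => v) (D.branchAt p κ)

end LevelDatum

/-- `IsLevel p d M T`: the parametrized tree `T`, defined on the definable set `M`, is of
level `d`. -/
def IsLevel (p : ℕ) : (d : ℕ) → {m : ℕ} → (M : Set (Fin m → ℤ)) → (M → Tree) → Prop
  | 0, _, M, T =>
      DefinableSet M ∧ ∃ D : SkeletonDatum M, ∀ κ, (T κ).Isomorphic (D.tree κ)
  | d + 1, _, M, T =>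
      DefinableSet M ∧ ∃ D : LevelDatum M,
        (∀ v w, IsLevel p d M ((D.jointBranch v).side w)) ∧
        (∀ e c w, IsLevel p d (D.skeleton.boneParams e D.ρ c) ((D.boneBranch e c).side w)) ∧
        ∀ κ, (T κ).Isomorphic (D.tree p κ)

/-- An (unparametrized) tree of level `d`: a tree of level `d` with parameters in the one-point
set `ℤ^0`. -/
def IsLevelTree (p : ℕ) (d : ℕ) (T : Tree) : Prop :=
  IsLevel p d (m := 0) Set.univ (fun _ => T)

end PadicTrees

end

/-! Congruence balls in `V(ℤ_p)` are eventually copies of `ℤ_p^d`. Near a point `x` with `V` smooth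
at `x(η)`, the points congruent to `x` modulo some `p^N` are parametrized by `ℤ_p^d` so that
congruence modulo `p^(N+k)` in `V` is congruence modulo `p^k` in `ℤ_p^d` (`IsPadicBall`). Finitely
many affine charts, each with a compact set of points, give one `N` for all points. Then `T(V)` cut
at depth `N` is finite, and below each of its nodes at depth `N` hangs a `T(ℤ_p^d)`; this is (1).

For the ball at `x`, take a chart with ring `A = ℤ_p[X]/I`, `I = (F_1, …, F_r)`, and `g ∈ A` with
`x(g) ≠ 0` and `A_g` smooth. Instead of Jacobian minors, the proof uses that the square-zero
extension of `A` by `I/I²` splits after inverting `g`. Clearing denominators gives `h F_j + ∑ ∂_i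
F_j e_i ∈ I²` with `e_i ∈ I` (`exists_firstOrder_retraction`). Writing `e_i` in terms of the `F_j`
and evaluating near `x` shows that the derivative `J` at `x` has the approximate generalized inverse
`-a/H`, where `H = h(x) ≠ 0`. Newton iteration then works although `J` need not be surjective, and
the zeros near `x` are parametrized by `ker J`, of rank `d` (`NewtonData.exists_chart`). The bound
on `d` holds because the `d` coordinates are regular functions taking all values in a ball of
`ℤ_p^d`, hence are algebraically independent on the generic fibre (`exists_algebra_chart`,
`le_ringKrullDim_of_injective`).

For (2), `T(ℤ_p^0)` is an infinite path, that is, a bone of infinite length, while `T(ℤ_p^(d+1)) =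
T(ℤ_p) × T(ℤ_p^d)` is a side branch at a real joint. So the finite tree, with infinite bones below
the leaves with `d_w = 0`, is a skeleton; all other side branches are trivial
(`attachLeaves_isomorphic_ext`, `isLevelTree_attachLeaves`). -/

noncomputable section

namespace PadicTrees

/-! ### Divisibility by powers of `p` in `ℤ_p`-modules -/

section Newton

variable (p : ℕ) [Fact p.Prime]

/-- The submodule of elements of a `ℤ_p`-module which are divisible by `p ^ k`. -/
def powSub (M : Type*) [AddCommGroup M] [Module ℤ_[p] M] (k : ℕ) : Submodule ℤ_[p] M :=
  LinearMap.range (((p : ℤ_[p]) ^ k) • (LinearMap.id : M →ₗ[ℤ_[p]] M))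

section

variable {p} {M N : Type*} [AddCommGroup M] [Module ℤ_[p] M] [AddCommGroup N] [Module ℤ_[p] N]

theorem mem_powSub {k : ℕ} {v : M} : v ∈ powSub p M k ↔ ∃ w, (p : ℤ_[p]) ^ k • w = v := by
  simp [powSub]

theorem pow_smul_mem_powSub (k : ℕ) (v : M) : (p : ℤ_[p]) ^ k • v ∈ powSub p M k :=
  mem_powSub.2 ⟨v, rfl⟩

theorem powSub_mono {k l : ℕ} (h : k ≤ l) : powSub p M l ≤ powSub p M k := by
  intro v hv
  obtain ⟨w, rfl⟩ := mem_powSub.1 hv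
  obtain ⟨j, rfl⟩ := Nat.exists_eq_add_of_le h
  rw [pow_add, mul_smul]
  exact pow_smul_mem_powSub _ _

theorem map_mem_powSub (f : M →ₗ[ℤ_[p]] N) {k : ℕ} {v : M} (hv : v ∈ powSub p M k) :
    f v ∈ powSub p N k := by
  obtain ⟨w, rfl⟩ := mem_powSub.1 hv
  rw [map_smul]
  exact pow_smul_mem_powSub _ _

theorem pow_smul_mem_powSub_add {k : ℕ} (j : ℕ) {v : M} (hv : v ∈ powSub p M k) :
    (p : ℤ_[p]) ^ j • v ∈ powSub p M (j + k) := by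
  obtain ⟨w, rfl⟩ := mem_powSub.1 hv
  rw [smul_smul, ← pow_add]
  exact pow_smul_mem_powSub _ _

theorem mem_powSub_zero (v : M) : v ∈ powSub p M 0 := mem_powSub.2 ⟨v, by simp⟩

theorem mem_powSub_pi {ι : Type*} {k : ℕ} {v : ι → ℤ_[p]} :
    v ∈ powSub p (ι → ℤ_[p]) k ↔ ∀ i, (p : ℤ_[p]) ^ k ∣ v i := by
  rw [mem_powSub]
  constructor
  · rintro ⟨w, rfl⟩ i
    exact ⟨w i, rfl⟩
  · intro h
    choose w hw using h
    exact ⟨w, funext fun i => (hw i).symm⟩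

theorem pow_p_ne_zero (k : ℕ) : (p : ℤ_[p]) ^ k ≠ 0 := pow_ne_zero _ PadicInt.prime_p.ne_zero

theorem of_pow_smul_mem_powSub {ι : Type*} {j k : ℕ} {v : ι → ℤ_[p]}
    (hv : (p : ℤ_[p]) ^ j • v ∈ powSub p (ι → ℤ_[p]) (j + k)) : v ∈ powSub p (ι → ℤ_[p]) k := by
  obtain ⟨w, hw⟩ := mem_powSub.1 hv
  rw [pow_add, mul_smul] at hw
  exact mem_powSub.2 ⟨w, smul_right_injective _ (pow_p_ne_zero j) hw⟩

theorem smul_unit_mem_powSub {k : ℕ} {v : M} (u : ℤ_[p]ˣ) (hv : (u : ℤ_[p]) • v ∈ powSub p M k) :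
    v ∈ powSub p M k := by
  have := (powSub p M k).smul_mem (↑u⁻¹ : ℤ_[p]) hv
  rwa [smul_smul, Units.inv_mul, one_smul] at this

theorem isClosed_powSub {ι : Type*} (k : ℕ) :
    IsClosed (powSub p (ι → ℤ_[p]) k : Set (ι → ℤ_[p])) := by
  have : (powSub p (ι → ℤ_[p]) k : Set (ι → ℤ_[p])) =
      ⋂ i, {v | ‖v i‖ ≤ (p : ℝ) ^ (-k : ℤ)} := by
    ext v
    simp only [SetLike.mem_coe, mem_powSub_pi, Set.mem_iInter, Set.mem_ofPred_eq,
      PadicInt.norm_le_pow_iff_mem_span_pow, Ideal.mem_span_singleton]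
  rw [this]
  exact isClosed_iInter fun i => isClosed_le (by fun_prop) continuous_const

theorem eq_zero_of_forall_mem_powSub {ι : Type*} {v : ι → ℤ_[p]}
    (h : ∀ k, v ∈ powSub p (ι → ℤ_[p]) k) : v = 0 := by
  funext i
  by_contra hi
  have hfin := FiniteMultiplicity.of_prime_left PadicInt.prime_p hi
  obtain ⟨k, hk⟩ := hfin
  exact hk (mem_powSub_pi.1 (h (k + 1)) i)

end

/-! ### A Newton iteration at a point with a generalized inverse of the derivative -/

section Abstract

variable {p} {n r d : ℕ}

/-- The data for the Newton iteration at a zero `x` of `F`: `J` is the derivative of `F` at `x`,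
and `-a / H` is a generalized inverse of `J`, which reduces zeros modulo `p ^ k` to better zeros. -/
structure NewtonData (x : Fin n → ℤ_[p]) (F : (Fin n → ℤ_[p]) → Fin r → ℤ_[p])
    (J : (Fin n → ℤ_[p]) →ₗ[ℤ_[p]] Fin r → ℤ_[p])
    (a : (Fin r → ℤ_[p]) →ₗ[ℤ_[p]] Fin n → ℤ_[p]) (H : ℤ_[p]) : Prop where
  continuous : Continuous F
  zero : F x = 0
  ne_zero : H ≠ 0
  -- `J` is the derivative at `x`, not at `y`: replacing one by the other costs `p^(N+k)`, and the
  -- second order term costs `p^(2k)`, which `N ≤ k` absorbs.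
  taylor : ∀ N y δ k, y - x ∈ powSub p (Fin n → ℤ_[p]) N → δ ∈ powSub p (Fin n → ℤ_[p]) k → N ≤ k →
    F (y + δ) - F y - J δ ∈ powSub p (Fin r → ℤ_[p]) (N + k)
  approx : ∀ N y k, y - x ∈ powSub p (Fin n → ℤ_[p]) N → F y ∈ powSub p (Fin r → ℤ_[p]) k → N ≤ k →
    H • F y + J (a (F y)) ∈ powSub p (Fin r → ℤ_[p]) (N + k)

variable {x : Fin n → ℤ_[p]} {F : (Fin n → ℤ_[p]) → Fin r → ℤ_[p]}
    {J : (Fin n → ℤ_[p]) →ₗ[ℤ_[p]] Fin r → ℤ_[p]}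
    {a : (Fin r → ℤ_[p]) →ₗ[ℤ_[p]] Fin n → ℤ_[p]} {H : ℤ_[p]}

/-- Apply `approx` at `y = x + p^k w`, where `F y` is `p^k J w` up to `p^(2k)`. Dividing by `p^k`
leaves an error in `p^k` for every `k`, so the relation `(H + J a) J = 0` is exact. -/
theorem NewtonData.comp_eq_zero (D : NewtonData x F J a H) (w : Fin n → ℤ_[p]) :
    J (H • w + a (J w)) = 0 := by
  refine eq_zero_of_forall_mem_powSub (p := p) fun k => ?_
  have hδ := pow_smul_mem_powSub (p := p) k w
  have hy : x + (p : ℤ_[p]) ^ k • w - x ∈ powSub p (Fin n → ℤ_[p]) k := by simpa using hδ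
  have h1 := D.taylor k x _ k (by simp) hδ le_rfl
  rw [D.zero, sub_zero] at h1
  set y := x + (p : ℤ_[p]) ^ k • w
  set δ := (p : ℤ_[p]) ^ k • w
  have h2 : F y ∈ powSub p (Fin r → ℤ_[p]) k := by
    have := (powSub p _ k).add_mem (powSub_mono (Nat.le_add_left k k) h1) (map_mem_powSub J hδ)
    simpa using this
  have h3 := D.approx k y k hy h2 le_rfl
  have h4 := (powSub p _ (k + k)).sub_mem h3 ((powSub p _ (k + k)).add_mem
    ((powSub p _ (k + k)).smul_mem H h1) (map_mem_powSub (J ∘ₗ a) h1))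
  have h5 : H • F y + J (a (F y)) - (H • (F y - J δ) + (J ∘ₗ a) (F y - J δ)) =
      (p : ℤ_[p]) ^ k • J (H • w + a (J w)) := by
    simp only [LinearMap.comp_apply, map_sub, map_add, map_smul, δ, smul_sub, smul_add]
    rw [smul_comm H]
    abel
  rw [h5] at h4
  exact of_pow_smul_mem_powSub h4

/-- Near the zero `x` of `F`, the coordinate map `q` to the kernel of the derivative identifies
the set of zeros of `F` with a ball. -/
theorem NewtonData.exists_chart (D : NewtonData x F J a H)
    (q : (Fin n → ℤ_[p]) →ₗ[ℤ_[p]] Fin d → ℤ_[p]) (s : (Fin d → ℤ_[p]) →ₗ[ℤ_[p]] Fin n → ℤ_[p])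
    (hqs : ∀ z, q (s z) = z) (hJs : ∀ z, J (s z) = 0) (hsq : ∀ v, J v = 0 → s (q v) = v) :
    ∃ N : ℕ, (∀ y y', F y = 0 → F y' = 0 → y - x ∈ powSub p (Fin n → ℤ_[p]) N →
        y' - x ∈ powSub p (Fin n → ℤ_[p]) N →
        ∀ k, q (y - y') ∈ powSub p (Fin d → ℤ_[p]) k → y - y' ∈ powSub p (Fin n → ℤ_[p]) k) ∧
      (∀ z ∈ powSub p (Fin d → ℤ_[p]) N,
        ∃ y, F y = 0 ∧ y - x ∈ powSub p (Fin n → ℤ_[p]) N ∧ q (y - x) = z) := by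
  set u := PadicInt.unitCoeff D.ne_zero
  set c := H.valuation
  have hH : H = u * (p : ℤ_[p]) ^ c := PadicInt.unitCoeff_spec D.ne_zero
  -- Dividing by `H` loses `c` digits; as `N ≥ c + 1`, each step still gains at least one digit.
  refine ⟨2 * c + 1, ?_, ?_⟩
  · intro y y' hy hy' hyx hyx' k
    set N := 2 * c + 1
    have hw : y - y' ∈ powSub p (Fin n → ℤ_[p]) N := by
      simpa using (powSub p _ N).sub_mem hyx hyx'
    induction k with
    | zero => intro _; exact mem_powSub_zero _
    | succ k ih =>
      intro hq
      have hk := ih (powSub_mono k.le_succ hq)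
      rcases le_or_gt (k + 1) N with h | h
      · exact powSub_mono h hw
      -- Both `y` and `y'` are zeros, so the Taylor estimate bounds `J (y - y')` itself.
      have hT := D.taylor N y' (y - y') k hyx' hk (by omega)
      rw [add_sub_cancel, hy, hy', sub_zero, zero_sub, neg_mem_iff] at hT
      obtain ⟨w, hw0⟩ := mem_powSub.1 hk
      rw [← hw0, map_smul, add_comm] at hT
      rw [← hw0, map_smul] at hq
      have hJw := of_pow_smul_mem_powSub hT
      have hqw := of_pow_smul_mem_powSub hq
      -- `H w + a (J w)` lies in `ker J` and is recovered from its `q`-coordinates. This expresses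
      -- `H w` through `q w`, divisible by `p`, and `J w`, divisible by `p^N`.
      have h1 := hsq _ (D.comp_eq_zero w)
      have h2 : H • w = H • s (q w) + s (q (a (J w))) - a (J w) := by
        rw [eq_sub_iff_add_eq, ← h1]
        simp
      have h3 : H • w ∈ powSub p (Fin n → ℤ_[p]) (c + 1) := by
        rw [h2]
        refine (powSub p _ _).sub_mem ((powSub p _ _).add_mem ?_ ?_) ?_
        · rw [hH, mul_smul]
          exact (powSub p _ _).smul_mem _ (pow_smul_mem_powSub_add c (map_mem_powSub s hqw))
        · exact powSub_mono (by omega) (map_mem_powSub (s ∘ₗ q ∘ₗ a) hJw)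
        · exact powSub_mono (by omega) (map_mem_powSub a hJw)
      rw [hH, mul_smul] at h3
      have h4 := of_pow_smul_mem_powSub (smul_unit_mem_powSub u h3)
      rw [← hw0]
      exact pow_smul_mem_powSub_add k h4
  · intro z hz
    set N := 2 * c + 1 with hN
    -- Approximate zeros with the prescribed coordinate `z`: nested closed subsets of a compact
    -- space. It suffices that each is non-empty; convergence of the iteration is not needed.
    let K : ℕ → Set (Fin n → ℤ_[p]) := fun k => {y | y - x ∈ powSub p (Fin n → ℤ_[p]) N ∧
      q (y - x) = z ∧ F y ∈ powSub p (Fin r → ℤ_[p]) (2 * N + k)}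
    have hq : Continuous q := LinearMap.continuous_on_pi q
    have hclosed : ∀ k, IsClosed (K k) := fun k =>
      ((isClosed_powSub N).preimage (by fun_prop)).inter
        ((isClosed_eq (by fun_prop) continuous_const).inter
          ((isClosed_powSub (2 * N + k)).preimage D.continuous))
    have hne : ∀ k, (K k).Nonempty := by
      intro k
      induction k with
      | zero =>
        have hs := map_mem_powSub s hz
        refine ⟨x + s z, by simpa using hs, by simp [hqs], ?_⟩
        have := D.taylor N x (s z) N (by simp) hs le_rfl
        rw [D.zero, hJs, sub_zero, sub_zero] at this
        exact powSub_mono (by omega) this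
      | succ k ih =>
        obtain ⟨y, hy, hyq, hyF⟩ := ih
        set M := 2 * N + k with hM
        obtain ⟨F', hF'⟩ := mem_powSub.1 hyF
        -- This is the Newton correction `H⁻¹ a (F y)`, integral because `F y` is divisible by `p^M`
        -- with `M ≥ c`.
        set δ0 := (p : ℤ_[p]) ^ (M - c) • (↑u⁻¹ : ℤ_[p]) • a F' with hδ0
        have hδ0m : δ0 ∈ powSub p (Fin n → ℤ_[p]) (M - c) := pow_smul_mem_powSub _ _
        -- Subtracting a vector of `ker J` keeps the coordinate `q (y - x) = z` and does not change
        -- `J δ0`.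
        set δ := δ0 - s (q δ0) with hδ
        have hδm : δ ∈ powSub p (Fin n → ℤ_[p]) (M - c) :=
          (powSub p _ _).sub_mem hδ0m (map_mem_powSub (s ∘ₗ q) hδ0m)
        refine ⟨y + δ, ?_, ?_, ?_⟩
        · rw [add_sub_right_comm]
          exact (powSub p _ _).add_mem hy (powSub_mono (by omega) hδm)
        · rw [add_sub_right_comm, map_add, hyq, hδ, map_sub, hqs, sub_self, add_zero]
        · have h1 := D.taylor N y δ (M - c) hy hδm (by omega)
          have h2 := D.approx N y M hy hyF (by omega)
          have hJδ : J δ = J δ0 := by rw [hδ, map_sub, hJs, sub_zero]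
          have h3 : (u : ℤ_[p]) • (p : ℤ_[p]) ^ c • (F y + J δ) = H • F y + J (a (F y)) := by
            rw [hJδ, hδ0, ← hF', smul_add, smul_add, hH, mul_smul]
            congr 1
            simp only [map_smul, smul_smul]
            congr 1
            have : (p : ℤ_[p]) ^ M = (p : ℤ_[p]) ^ c * (p : ℤ_[p]) ^ (M - c) := by
              rw [← pow_add]; congr 1; omega
            rw [this]
            have hu := u.mul_inv
            linear_combination ((p : ℤ_[p]) ^ c * (p : ℤ_[p]) ^ (M - c)) * hu
          rw [← h3] at h2
          have h4 := smul_unit_mem_powSub u h2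
          rw [show N + M = c + (N + M - c) by omega] at h4
          have h5 := of_pow_smul_mem_powSub h4
          have h6 := (powSub p _ (M + 1)).add_mem (powSub_mono (by omega) h1)
            (powSub_mono (by omega) h5)
          have h7 : F (y + δ) - F y - J δ + (F y + J δ) = F (y + δ) := by abel
          rw [h7] at h6
          exact powSub_mono (by omega) h6
    obtain ⟨y, hy⟩ := IsCompact.nonempty_iInter_of_sequence_nonempty_isCompact_isClosed K
      (fun k y hy => ⟨hy.1, hy.2.1, powSub_mono (by omega) hy.2.2⟩) hne (hclosed 0).isCompact
      hclosed
    rw [Set.mem_iInter] at hy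
    exact ⟨y, eq_zero_of_forall_mem_powSub fun k => powSub_mono (by omega) (hy k).2.2,
      (hy 0).1, (hy 0).2.1⟩

/-- A linear map between free modules has split kernel. -/
theorem exists_ker_splitting (J : (Fin n → ℤ_[p]) →ₗ[ℤ_[p]] Fin r → ℤ_[p]) :
    ∃ (d : ℕ) (q : (Fin n → ℤ_[p]) →ₗ[ℤ_[p]] Fin d → ℤ_[p])
      (s : (Fin d → ℤ_[p]) →ₗ[ℤ_[p]] Fin n → ℤ_[p]),
      (∀ z, q (s z) = z) ∧ (∀ z, J (s z) = 0) ∧ (∀ v, J v = 0 → s (q v) = v) := by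
  -- Over the principal ideal domain `ℤ_p` the image of `J` is free, so `J` splits over it; the
  -- kernel is free for the same reason.
  obtain ⟨t, ht⟩ := Module.projective_lifting_property J.rangeRestrict LinearMap.id
    J.surjective_rangeRestrict
  have ht' : ∀ w, J (t w) = w := fun w => congrArg Subtype.val (LinearMap.congr_fun ht w)
  let π : (Fin n → ℤ_[p]) →ₗ[ℤ_[p]] LinearMap.ker J :=
    (LinearMap.id - t ∘ₗ J.rangeRestrict).codRestrict _ (by
      intro v
      simp [ht'])
  let b := Module.finBasis ℤ_[p] (LinearMap.ker J)
  refine ⟨_, b.equivFun.toLinearMap ∘ₗ π, (LinearMap.ker J).subtype ∘ₗ b.equivFun.symm.toLinearMap,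
    ?_, ?_, ?_⟩
  · intro z
    have : π (b.equivFun.symm z : LinearMap.ker J) = b.equivFun.symm z := by
      apply Subtype.ext
      have h0 : J.rangeRestrict (b.equivFun.symm z : LinearMap.ker J).1 = 0 :=
        Subtype.ext (b.equivFun.symm z : LinearMap.ker J).2
      simp only [π, LinearMap.codRestrict_apply, LinearMap.sub_apply, LinearMap.id_apply,
        LinearMap.comp_apply, h0, map_zero, sub_zero]
    change b.equivFun (π (b.equivFun.symm z : LinearMap.ker J)) = z
    rw [this, LinearEquiv.apply_symm_apply]
  · intro z
    exact (b.equivFun.symm z : LinearMap.ker J).2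
  · intro v hv
    have h0 : J.rangeRestrict v = 0 := Subtype.ext hv
    change ((b.equivFun.symm (b.equivFun (π v)) : LinearMap.ker J) : Fin n → ℤ_[p]) = v
    rw [LinearEquiv.symm_apply_apply]
    simp only [π, LinearMap.codRestrict_apply, LinearMap.sub_apply, LinearMap.id_apply,
        LinearMap.comp_apply, h0, map_zero, sub_zero]

end Abstract

end Newton

/-! ### Taylor expansion to first order -/

section Taylor

open MvPolynomial

theorem aeval_add_of_mul_eq_zero {R S σ : Type*} [CommRing R] [CommRing S] [Algebra R S] [Fintype σ]
    (x c : σ → S) (hc : ∀ i j, c i * c j = 0) (f : MvPolynomial σ R) :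
    aeval (x + c) f = aeval x f + ∑ i, aeval x (pderiv i f) * c i := by
  classical
  induction f using MvPolynomial.induction_on with
  | C a => simp
  | add f g hf hg =>
    simp only [map_add, hf, hg, add_mul, Finset.sum_add_distrib]
    ring
  | mul_X f j hf =>
    have h1 : ∀ i, aeval x (pderiv i (f * X j)) * c i =
        aeval x (pderiv i f) * c i * x j + aeval x f * (Pi.single j 1 : σ → S) i * c i := by
      intro i
      rw [Derivation.leibniz, pderiv_X, Pi.single_apply, Pi.single_apply]
      rcases eq_or_ne i j with rfl | h
      · simp
        ring
      · simp [h, h.symm]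
        ring
    have h2 : (∑ i, aeval x (pderiv i f) * c i) * c j = 0 := by
      rw [Finset.sum_mul]
      exact Finset.sum_eq_zero fun i _ => by rw [mul_assoc, hc, mul_zero]
    rw [map_mul, hf, Finset.sum_congr rfl fun i _ => h1 i, Finset.sum_add_distrib,
      ← Finset.sum_mul, map_mul]
    simp only [aeval_X, Pi.add_apply, mul_assoc, Pi.single_apply]
    simp only [ite_mul, one_mul, zero_mul, mul_ite, mul_zero, Finset.sum_ite_eq',
      Finset.mem_univ, if_true]
    linear_combination h2

/-- Modulo `I²` all products `c i * c j` vanish, so the Taylor expansion stops after the linear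
term. -/
theorem eval_add_sub_mem {R σ : Type*} [CommRing R] [Fintype σ] (I : Ideal R) (x c : σ → R)
    (hc : ∀ i, c i ∈ I) (f : MvPolynomial σ R) :
    eval (x + c) f - eval x f - ∑ i, eval x (pderiv i f) * c i ∈ I ^ 2 := by
  have key := aeval_add_of_mul_eq_zero (R := R) (S := R ⧸ I ^ 2)
    (fun i => algebraMap R _ (x i)) (fun i => algebraMap R _ (c i)) (fun i j => by
      rw [← map_mul]
      refine Ideal.Quotient.eq_zero_iff_mem.2 ?_
      rw [pow_two]
      exact Ideal.mul_mem_mul (hc i) (hc j)) f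
  have h : ∀ (y : σ → R) (g : MvPolynomial σ R),
      aeval (fun i => algebraMap R (R ⧸ I ^ 2) (y i)) g = algebraMap R _ (eval y g) := fun y g => by
    rw [← aeval_eq_eval]
    exact aeval_algebraMap_apply _ y g
  have h' : (fun i => algebraMap R (R ⧸ I ^ 2) (x i)) + (fun i => algebraMap R (R ⧸ I ^ 2) (c i)) =
      fun i => algebraMap R (R ⧸ I ^ 2) ((x + c) i) := by
    funext i
    exact (map_add (algebraMap R (R ⧸ I ^ 2)) _ _).symm
  rw [h'] at key
  simp only [h] at key
  rw [← Ideal.Quotient.eq_zero_iff_mem]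
  rw [← Ideal.Quotient.algebraMap_eq]
  simp only [map_sub, map_sum, map_mul]
  rw [key]
  ring

theorem eval_sub_eval_mem {R σ : Type*} [CommRing R] (I : Ideal R) (x y : σ → R)
    (h : ∀ i, y i - x i ∈ I) (f : MvPolynomial σ R) : eval y f - eval x f ∈ I := by
  rw [← Ideal.Quotient.eq_zero_iff_mem, map_sub, sub_eq_zero, ← RingHom.comp_apply,
    ← RingHom.comp_apply]
  congr 1
  refine ringHom_ext (fun r => by simp) fun i => ?_
  simp only [RingHom.comp_apply, eval_X]
  exact Ideal.Quotient.eq.2 (h i)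

end Taylor

/-! ### Retractions of first order neighbourhoods, from formal smoothness -/

section Smooth

open MvPolynomial

/-- Exactness of localization: the image of the numerator is killed by a power of `f a`, and this
power is absorbed into `k`. -/
theorem exists_pow_mul_of_awayMap_eq_zero {R Q A B : Type*} [CommRing R] [CommRing Q] [CommRing A]
    [CommRing B] [Algebra R Q] [Algebra R A] [Algebra A B] [Algebra R B] [IsScalarTower R A B]
    (f : Q →ₐ[R] A) (a : Q) [IsLocalization.Away (f a) B] {z : Localization.Away a}
    (hz : IsLocalization.Away.mapₐ (Localization.Away a) B f a z = 0) :
    ∃ (k : ℕ) (b : Q), f b = 0 ∧ z * algebraMap Q _ a ^ k = algebraMap Q _ b := by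
  obtain ⟨k, c, hc⟩ := IsLocalization.Away.surj a z
  have h1 : algebraMap A B (f c) = 0 := by
    have := congrArg (IsLocalization.Away.mapₐ (Localization.Away a) B f a) hc
    rw [map_mul, hz, zero_mul] at this
    rw [this]
    simp [IsLocalization.Away.map]
  obtain ⟨⟨_, m, rfl⟩, hm⟩ := (IsLocalization.map_eq_zero_iff (Submonoid.powers (f a)) _ _).1 h1
  refine ⟨k + m, a ^ m * c, by simpa using hm, ?_⟩
  rw [pow_add, ← mul_assoc, hc, map_mul, map_pow, mul_comm]

/-- With `Q = ℤ[X]/I²` formed over `R`, the map `Q_a → A_g` is surjective with square-zero kernel,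
so formal smoothness yields a section `σ`. Moving the tautological point `x` of `Q_a` by `c = σ(X) -
x` gives a point at which all of `I` vanishes. The first order expansion of `F j` at `x + c` is the
desired relation up to powers of `a`. -/
theorem exists_firstOrder_retraction {R A : Type} [CommRing R] [CommRing A] [Algebra R A] {n r : ℕ}
    (π : MvPolynomial (Fin n) R →ₐ[R] A) (hπ : Function.Surjective π)
    (F : Fin r → MvPolynomial (Fin n) R) (hF : Ideal.span (Set.range F) = RingHom.ker π) (g : A)
    [Algebra.FormallySmooth R (Localization.Away g)] :
    ∃ (h : MvPolynomial (Fin n) R) (e : Fin n → MvPolynomial (Fin n) R) (K : ℕ), π h = g ^ K ∧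
      (∀ i, e i ∈ RingHom.ker π) ∧
      ∀ j, h * F j + ∑ i, pderiv i (F j) * e i ∈ RingHom.ker π ^ 2 := by
  set I := RingHom.ker π
  obtain ⟨a, rfl⟩ := hπ g
  let Q := MvPolynomial (Fin n) R ⧸ I ^ 2
  let mk : MvPolynomial (Fin n) R →ₐ[R] Q := Ideal.Quotient.mkₐ R (I ^ 2)
  let f : Q →ₐ[R] A := Ideal.Quotient.liftₐ (I ^ 2) π
    (fun b hb => (Ideal.pow_le_self two_ne_zero hb : b ∈ I))
  have hf : ∀ b, f (mk b) = π b := fun b => rfl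
  have hmk : Function.Surjective mk := Ideal.Quotient.mkₐ_surjective R _
  have hfs : Function.Surjective f := fun b => by
    obtain ⟨b, rfl⟩ := hπ b
    exact ⟨mk b, rfl⟩
  let B := Localization.Away (π a)
  have hB : IsLocalization.Away (f (mk a)) B := inferInstanceAs (IsLocalization.Away (π a) B)
  let φ : Localization.Away (mk a) →ₐ[R] B :=
    IsLocalization.Away.mapₐ (Localization.Away (mk a)) B f (mk a)
  have hφs : Function.Surjective φ := IsLocalization.Away.mapₐ_surjective_of_surjective _ hfs
  have hφX : ∀ b : Q, φ (algebraMap _ _ b) = algebraMap A B (f b) := fun b => by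
    simp [φ, IsLocalization.Away.map]
  have hker : ∀ z, φ z = 0 → ∃ (k : ℕ) (b : MvPolynomial (Fin n) R), b ∈ I ∧
      z * algebraMap Q _ (mk a) ^ k = algebraMap Q _ (mk b) := by
    intro z hz
    obtain ⟨k, b, hb, h⟩ := exists_pow_mul_of_awayMap_eq_zero f (mk a) hz
    obtain ⟨b, rfl⟩ := hmk b
    exact ⟨k, b, hb, h⟩
  have hunit : ∀ k, IsUnit (algebraMap Q (Localization.Away (mk a)) (mk a) ^ k) := fun k =>
    (IsLocalization.Away.algebraMap_isUnit (mk a)).pow k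
  have hmul : ∀ z z', φ z = 0 → φ z' = 0 → z * z' = 0 := by
    intro z z' hz hz'
    obtain ⟨k, b, hb, h⟩ := hker z hz
    obtain ⟨k', b', hb', h'⟩ := hker z' hz'
    have h0 : mk (b * b') = 0 := by
      refine Ideal.Quotient.eq_zero_iff_mem.2 ?_
      rw [pow_two]
      exact Ideal.mul_mem_mul hb hb'
    refine ((hunit k).mul (hunit k')).mul_left_eq_zero.1 ?_
    rw [mul_mul_mul_comm, h, h', ← map_mul, ← map_mul, h0, map_zero]
  have hnil : IsNilpotent (RingHom.ker (φ : Localization.Away (mk a) →+* B)) := by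
    refine ⟨2, (pow_two _).trans (eq_bot_iff.2 (Ideal.mul_le.2 ?_))⟩
    exact fun z hz z' hz' => hmul z z' hz hz'
  let σ : B →ₐ[R] Localization.Away (mk a) :=
    Algebra.FormallySmooth.liftOfSurjective (AlgHom.id R B) φ hφs hnil
  have hσ : ∀ z, φ (σ z) = z := fun z =>
    Algebra.FormallySmooth.liftOfSurjective_apply (AlgHom.id R B) φ hφs hnil z
  let x : Fin n → Localization.Away (mk a) := fun i => algebraMap Q _ (mk (X i))
  let c : Fin n → Localization.Away (mk a) := fun i => σ (algebraMap A B (π (X i))) - x i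
  have hc : ∀ i, φ (c i) = 0 := fun i => by
    simp only [c, map_sub, hσ, x, hφX, hf, sub_self]
  choose k e he hk using fun i => hker (c i) (hc i)
  have haevalx : ∀ b, aeval x b = algebraMap Q (Localization.Away (mk a)) (mk b) := by
    intro b
    have : aeval x = (IsScalarTower.toAlgHom R Q (Localization.Away (mk a))).comp mk :=
      algHom_ext fun i => by simp [x]
    rw [this]
    rfl
  have haeval : ∀ b ∈ I, aeval (x + c) b = 0 := by
    intro b hb
    have h1 : aeval (x + c) = (σ.comp (IsScalarTower.toAlgHom R A B)).comp
        π := algHom_ext fun i => by simp [c]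
    have h2 : π b = 0 := hb
    rw [h1, AlgHom.comp_apply, h2, map_zero]
  -- The sum serves only as a common bound for the exponents, as does `L` below.
  set K := ∑ i, k i
  have hkK : ∀ i, k i ≤ K := fun i => Finset.single_le_sum (fun _ _ => Nat.zero_le _)
    (Finset.mem_univ i)
  have hrel : ∀ j, ∃ m : ℕ, a ^ m * (a ^ K * F j + ∑ i, pderiv i (F j) * (a ^ (K - k i) * e i)) ∈
      I ^ 2 := by
    intro j
    have hFj : F j ∈ I := hF ▸ Ideal.subset_span ⟨j, rfl⟩
    have h1 := aeval_add_of_mul_eq_zero x c (fun i j => hmul _ _ (hc i) (hc j)) (F j)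
    rw [haeval _ hFj] at h1
    have h2 : algebraMap Q (Localization.Away (mk a))
        (mk (a ^ K * F j + ∑ i, pderiv i (F j) * (a ^ (K - k i) * e i))) = 0 := by
      simp only [haevalx] at h1
      simp only [map_add, map_mul, map_sum, map_pow]
      have h3 : ∀ i, algebraMap Q (Localization.Away (mk a)) (mk a) ^ (K - k i) *
          algebraMap Q (Localization.Away (mk a)) (mk (e i)) =
          algebraMap Q (Localization.Away (mk a)) (mk a) ^ K * c i := by
        intro i
        rw [← hk i]
        have : K = (K - k i) + k i := by have := hkK i; omega
        conv_rhs => rw [this, pow_add]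
        ring
      simp only [h3]
      have := congrArg (fun z => algebraMap Q (Localization.Away (mk a)) (mk a) ^ K * z) h1
      simp only [mul_zero, mul_add, Finset.mul_sum] at this
      rw [this]
      congr 1
      exact Finset.sum_congr rfl fun i _ => by ring
    -- Vanishing in the localization gives vanishing in `Q` only after multiplying by a further
    -- power of `a`.
    obtain ⟨⟨_, m, rfl⟩, hm⟩ := (IsLocalization.map_eq_zero_iff (Submonoid.powers (mk a)) _ _).1 h2
    refine ⟨m, Ideal.Quotient.eq_zero_iff_mem.1 ?_⟩
    rw [map_mul, map_pow]
    exact hm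
  choose m hm using hrel
  set L := ∑ j, m j
  have hmL : ∀ j, m j ≤ L := fun j => Finset.single_le_sum (fun _ _ => Nat.zero_le _)
    (Finset.mem_univ j)
  refine ⟨a ^ L * a ^ K, fun i => a ^ L * (a ^ (K - k i) * e i), L + K, by simp [pow_add],
    fun i => Ideal.mul_mem_left _ _ (Ideal.mul_mem_left _ _ (he i)), fun j => ?_⟩
  have := Ideal.mul_mem_left _ (a ^ (L - m j)) (hm j)
  rw [← mul_assoc, ← pow_add, Nat.sub_add_cancel (hmL j), mul_add, Finset.mul_sum] at this
  convert this using 2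
  · ring
  · exact Finset.sum_congr rfl fun i _ => by ring

end Smooth

/-! ### The Newton data of a system of polynomials -/

section NewtonData

open MvPolynomial

variable {p : ℕ} [Fact p.Prime] {n r : ℕ}

theorem mem_powSub_iff_mem_span {ι : Type*} {k : ℕ} {v : ι → ℤ_[p]} :
    v ∈ powSub p (ι → ℤ_[p]) k ↔ ∀ i, v i ∈ Ideal.span {(p : ℤ_[p]) ^ k} := by
  simp only [mem_powSub_pi, Ideal.mem_span_singleton]

/-- `J` is the Jacobian matrix at `x`, and `a` holds the values at `x` of the coefficients writing
`e i` in terms of the `F j`. If `F y` is divisible by `p^k`, then `I²` evaluates at `y` into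
`(p^(2k))`; replacing the coefficients at `y` by those at `x` costs `p^N` times `F y`. -/
theorem newtonData_of_polynomials (F : Fin r → MvPolynomial (Fin n) ℤ_[p])
    (h : MvPolynomial (Fin n) ℤ_[p]) (e : Fin n → MvPolynomial (Fin n) ℤ_[p])
    (he : ∀ i, e i ∈ Ideal.span (Set.range F))
    (hrel : ∀ j, h * F j + ∑ i, pderiv i (F j) * e i ∈ Ideal.span (Set.range F) ^ 2)
    (x : Fin n → ℤ_[p]) (hx : ∀ j, eval x (F j) = 0) (hh : eval x h ≠ 0) :
    ∃ J a H, NewtonData x (fun y j => eval y (F j)) J a H := by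
  have he' : ∀ i, ∃ a : Fin r → MvPolynomial (Fin n) ℤ_[p], ∑ j, a j * F j = e i := fun i => by
    obtain ⟨a, ha⟩ := (Ideal.mem_span_range_iff_exists_fun).1 (he i)
    exact ⟨a, ha⟩
  choose a ha using he'
  refine ⟨(Matrix.of fun j i => eval x (pderiv i (F j))).mulVecLin,
    (Matrix.of fun i j => eval x (a i j)).mulVecLin, eval x h, ?_, funext hx, hh, ?_, ?_⟩
  · exact continuous_pi fun j => (F j).continuous_eval
  · intro N y δ k hy hδ hNk
    rw [mem_powSub_iff_mem_span] at hy hδ ⊢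
    intro j
    have h1 := eval_add_sub_mem _ y δ hδ (F j)
    have h2 : eval (y + δ) (F j) - eval y (F j) -
        ∑ i, eval y (pderiv i (F j)) * δ i ∈ Ideal.span {(p : ℤ_[p]) ^ (N + k)} := by
      rw [Ideal.span_singleton_pow, ← pow_mul] at h1
      exact Ideal.span_singleton_le_span_singleton.2 (pow_dvd_pow _ (by omega)) h1
    have h3 : ∑ i, (eval y (pderiv i (F j)) - eval x (pderiv i (F j))) * δ i ∈
        Ideal.span {(p : ℤ_[p]) ^ (N + k)} := by
      refine Ideal.sum_mem _ fun i _ => ?_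
      rw [pow_add, ← Ideal.span_singleton_mul_span_singleton]
      exact Ideal.mul_mem_mul (eval_sub_eval_mem _ x y hy _) (hδ i)
    have h4 := Ideal.add_mem _ h2 h3
    convert h4 using 1
    simp only [Pi.sub_apply, Matrix.mulVecLin_apply, Matrix.mulVec, dotProduct, Matrix.of_apply,
      sub_mul, Finset.sum_sub_distrib]
    ring
  · intro N y k hy hF hNk
    rw [mem_powSub_iff_mem_span] at hy hF ⊢
    intro j
    have hI : Ideal.span (Set.range F) ≤ (Ideal.span {(p : ℤ_[p]) ^ k}).comap (eval y) := by
      rw [Ideal.span_le]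
      rintro _ ⟨l, rfl⟩
      exact hF l
    have h1 : eval y (h * F j + ∑ i, pderiv i (F j) * e i) ∈
        Ideal.span {(p : ℤ_[p]) ^ (N + k)} := by
      have h2 : _ ∈ (Ideal.span {(p : ℤ_[p]) ^ k} ^ 2).comap (eval y) :=
        Ideal.le_comap_pow _ 2 (Ideal.pow_right_mono hI 2 (hrel j))
      rw [Ideal.mem_comap, Ideal.span_singleton_pow, ← pow_mul] at h2
      exact Ideal.span_singleton_le_span_singleton.2 (pow_dvd_pow _ (by omega)) h2
    have hsub := fun f => eval_sub_eval_mem _ x y hy f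
    have h2 : (eval y h - eval x h) * eval y (F j) ∈ Ideal.span {(p : ℤ_[p]) ^ (N + k)} := by
      rw [pow_add, ← Ideal.span_singleton_mul_span_singleton]
      exact Ideal.mul_mem_mul (hsub h) (hF j)
    have h3 : ∑ i, ∑ l, (eval y (pderiv i (F j) * a i l) - eval x (pderiv i (F j) * a i l)) *
        eval y (F l) ∈ Ideal.span {(p : ℤ_[p]) ^ (N + k)} := by
      refine Ideal.sum_mem _ fun i _ => Ideal.sum_mem _ fun l _ => ?_
      rw [pow_add, ← Ideal.span_singleton_mul_span_singleton]
      exact Ideal.mul_mem_mul (hsub _) (hF l)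
    have h4 := Ideal.sub_mem _ (Ideal.sub_mem _ h1 h2) h3
    convert h4 using 1
    simp only [Pi.add_apply, Pi.smul_apply, smul_eq_mul, Matrix.mulVecLin_apply, Matrix.mulVec,
      dotProduct, Matrix.of_apply, ← ha, map_add, map_mul, map_sum, Finset.mul_sum, sub_mul,
      Finset.sum_sub_distrib, mul_assoc]
    ring

end NewtonData

/-! ### A lower bound for the dimension of an algebra of finite type -/

/-- A chain of primes lifts: lying over for its smallest member, going up for the rest. -/
theorem ringKrullDim_le_of_isIntegral_of_injective {R S : Type*} [CommRing R] [CommRing S]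
    [Algebra R S] [Algebra.IsIntegral R S] (h : Function.Injective (algebraMap R S)) :
    ringKrullDim R ≤ ringKrullDim S := by
  refine iSup_le fun l => ?_
  obtain ⟨P, -, hP, hP'⟩ := Ideal.exists_ideal_over_prime_of_isIntegral l.head.asIdeal (⊥ : Ideal S)
    (by
      change RingHom.ker (algebraMap R S) ≤ _
      rw [(RingHom.injective_iff_ker_eq_bot _).1 h]
      exact bot_le)
  have : P.LiesOver l.head.asIdeal := ⟨hP'.symm⟩
  obtain ⟨L, hL, -⟩ := Ideal.exists_ltSeries_of_hasGoingUp l P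
  rw [← hL]
  exact Order.LTSeries.length_le_krullDim L

/-- Some prime `Q` of `B` contracts to zero, so the polynomial ring still embeds into the domain `B
⧸ Q`. By Noether normalization the latter is integral over a polynomial ring in `s` variables, and
comparing transcendence degrees gives `d ≤ s`. -/
theorem le_ringKrullDim_of_injective {k B : Type} [Field k] [CommRing B] [Algebra k B]
    [Algebra.FiniteType k B] {d : ℕ} (φ : MvPolynomial (Fin d) k →ₐ[k] B)
    (hφ : Function.Injective φ) : (d : WithBot ℕ∞) ≤ ringKrullDim B := by
  obtain ⟨Q, hQ, hQφ⟩ := Ideal.exists_comap_eq_of_mem_minimalPrimes_of_injective (f := φ.toRingHom)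
    hφ (p := ⊥) (by rw [IsDomain.minimalPrimes_eq_singleton_bot]; rfl)
  let C := B ⧸ Q
  have hψ : Function.Injective ((Ideal.Quotient.mkₐ k Q).comp φ) := by
    rw [injective_iff_map_eq_zero]
    intro a ha
    have : a ∈ Q.comap φ.toRingHom := Ideal.Quotient.eq_zero_iff_mem (I := Q) (a := φ a) |>.1 ha
    rwa [hQφ] at this
  obtain ⟨s, g, hg, hint⟩ := exists_integral_inj_algHom_of_fg k C
  algebraize [g.toRingHom]
  have : FaithfulSMul (MvPolynomial (Fin s) k) C := (faithfulSMul_iff_algebraMap_injective _ _).2 hg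
  have hT : IsScalarTower k (MvPolynomial (Fin s) k) C := .of_algebraMap_eq fun r =>
    (g.commutes r).symm
  have h1 := trdeg_add_eq k (MvPolynomial (Fin s) k) (A := C)
  have h2 := trdeg_le_of_injective _ hψ
  rw [trdeg_eq_zero (R := MvPolynomial (Fin s) k), add_zero, MvPolynomial.trdeg_of_isDomain] at h1
  rw [← h1, MvPolynomial.trdeg_of_isDomain] at h2
  have hds : d ≤ s := by simpa using h2
  have h3 := ringKrullDim_add_natCard_le_ringKrullDim_mvPolynomial (R := k) (Fin s)
  rw [ringKrullDim_eq_zero_of_field, zero_add, Nat.card_fin] at h3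
  calc (d : WithBot ℕ∞) ≤ s := by exact_mod_cast hds
    _ ≤ ringKrullDim (MvPolynomial (Fin s) k) := h3
    _ ≤ ringKrullDim C := ringKrullDim_le_of_isIntegral_of_injective hg
    _ ≤ ringKrullDim B := ringKrullDim_quotient_le Q

/-! ### The local structure of the set of points of an algebra -/

section Chart

open MvPolynomial TensorProduct

variable {p : ℕ} [Fact p.Prime] {A : Type} [CommRing A] [Algebra ℤ_[p] A]

/-- Two `ℤ_p`-valued points of a `ℤ_p`-algebra are congruent modulo `p ^ n`. -/
def HomCongr (n : ℕ) (y y' : A →ₐ[ℤ_[p]] ℤ_[p]) : Prop :=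
  ∀ b, y b - y' b ∈ Ideal.span {(p : ℤ_[p]) ^ n}

/-- The coordinates of a point of `A` with respect to a presentation of `A`. -/
def coords {n : ℕ} (π : MvPolynomial (Fin n) ℤ_[p] →ₐ[ℤ_[p]] A) (y : A →ₐ[ℤ_[p]] ℤ_[p]) :
    Fin n → ℤ_[p] := fun i => y (π (X i))

variable {n : ℕ} {π : MvPolynomial (Fin n) ℤ_[p] →ₐ[ℤ_[p]] A}

theorem apply_eq_eval_coords (y : A →ₐ[ℤ_[p]] ℤ_[p]) (f : MvPolynomial (Fin n) ℤ_[p]) :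
    y (π f) = eval (coords π y) f := by
  rw [← aeval_eq_eval]
  have : y.comp π = aeval (coords π y) := algHom_ext fun i => by simp [coords]
  exact DFunLike.congr_fun this f

theorem homCongr_iff_coords (hπ : Function.Surjective π) (k : ℕ) (y y' : A →ₐ[ℤ_[p]] ℤ_[p]) :
    HomCongr k y y' ↔ coords π y - coords π y' ∈ powSub p (Fin n → ℤ_[p]) k := by
  rw [mem_powSub_iff_mem_span]
  constructor
  · exact fun h i => h _
  · intro h b
    obtain ⟨f, rfl⟩ := hπ b
    rw [apply_eq_eval_coords, apply_eq_eval_coords]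
    exact eval_sub_eval_mem _ _ _ h f

theorem coords_injective (hπ : Function.Surjective π) : Function.Injective (coords π) := by
  intro y y' h
  ext b
  obtain ⟨f, rfl⟩ := hπ b
  rw [apply_eq_eval_coords, apply_eq_eval_coords, h]

theorem exists_coords_eq (hπ : Function.Surjective π) (v : Fin n → ℤ_[p])
    (hv : ∀ f ∈ RingHom.ker π, eval v f = 0) : ∃ y, coords π y = v := by
  refine ⟨(Ideal.Quotient.liftₐ (RingHom.ker π) (aeval v) (fun f hf => ?_)).comp
    (Ideal.quotientKerAlgEquivOfSurjective hπ).symm.toAlgHom, ?_⟩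
  · rw [aeval_eq_eval]
    exact hv f hf
  · funext i
    have : (Ideal.quotientKerAlgEquivOfSurjective hπ).symm (π (X i : MvPolynomial (Fin n) ℤ_[p])) =
        Ideal.Quotient.mk _ (X i) := by
      rw [AlgEquiv.symm_apply_eq]
      rfl
    simp only [coords, AlgHom.comp_apply, AlgEquiv.coe_toAlgHom, this]
    exact (aeval_X v i)

theorem eval_eq_zero_of_forall_eval_pow {d N : ℕ} (G : MvPolynomial (Fin d) ℚ_[p])
    (hG : ∀ z : Fin d → ℤ_[p], eval (fun i => (((p : ℤ_[p]) ^ N * z i : ℤ_[p]) : ℚ_[p])) G = 0) :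
    G = 0 := by
  have hinj : Function.Injective fun z : ℤ_[p] => (((p : ℤ_[p]) ^ N * z : ℤ_[p]) : ℚ_[p]) :=
    Subtype.val_injective.comp (mul_right_injective₀ (pow_p_ne_zero N))
  refine funext_set (fun _ => Set.range fun z : ℤ_[p] => (((p : ℤ_[p]) ^ N * z : ℤ_[p]) : ℚ_[p]))
    (fun _ => Set.infinite_range_of_injective hinj) fun v hv => ?_
  choose z hz using fun i => hv i trivial
  have := hG z
  rw [map_zero, ← this]
  congr 2
  exact funext fun i => (hz i).symm

theorem exists_algebra_chart [Algebra.FiniteType ℤ_[p] A] (x : A →ₐ[ℤ_[p]] ℤ_[p]) (g : A)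
    (hg : x g ≠ 0) [Algebra.FormallySmooth ℤ_[p] (Localization.Away g)] :
    ∃ (N d : ℕ) (φ : (Fin d → ℤ_[p]) → A →ₐ[ℤ_[p]] ℤ_[p]),
      (d : WithBot ℕ∞) ≤ ringKrullDim (ℚ_[p] ⊗[ℤ_[p]] A) ∧
      (∀ y, HomCongr N y x ↔ ∃ z, φ z = y) ∧
      ∀ z z' k, HomCongr (N + k) (φ z) (φ z') ↔ z - z' ∈ powSub p (Fin d → ℤ_[p]) k := by
  obtain ⟨n, π, hπ⟩ := Algebra.FiniteType.iff_quotient_mvPolynomial''.1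
    (inferInstance : Algebra.FiniteType ℤ_[p] A)
  obtain ⟨r, F, hF⟩ := Submodule.fg_iff_exists_fin_generating_family.1
    (IsNoetherian.noetherian (RingHom.ker π))
  change Ideal.span _ = _ at hF
  obtain ⟨h, e, K, hh, he, hrel⟩ := exists_firstOrder_retraction π hπ F hF g
  rw [← hF] at he hrel
  have hzero : ∀ v, (∀ j, eval v (F j) = 0) → ∀ f ∈ RingHom.ker π, eval v f = 0 := by
    intro v hv f hf
    have : RingHom.ker π ≤ RingHom.ker (eval v) := by
      rw [← hF, Ideal.span_le]
      rintro _ ⟨j, rfl⟩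
      exact hv j
    exact this hf
  have hzero' : ∀ y : A →ₐ[ℤ_[p]] ℤ_[p], (fun j => eval (coords π y) (F j)) = 0 := by
    intro y
    funext j
    rw [← apply_eq_eval_coords]
    have : F j ∈ RingHom.ker π := hF ▸ Ideal.subset_span ⟨j, rfl⟩
    rw [(RingHom.mem_ker).1 this, map_zero]
    rfl
  obtain ⟨J, a, H, D⟩ := newtonData_of_polynomials F h e he hrel (coords π x)
    (fun j => congrFun (hzero' x) j) (by
      rw [← apply_eq_eval_coords, hh, map_pow]
      exact pow_ne_zero _ hg)
  obtain ⟨d, q, s, hqs, hJs, hsq⟩ := exists_ker_splitting J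
  obtain ⟨N, hinj, hsurj⟩ := D.exists_chart q s hqs hJs hsq
  -- Scaling by `p^N` turns the ball `p^N ℤ_p^d` of coordinates into `ℤ_p^d`.
  have hφ : ∀ z : Fin d → ℤ_[p], ∃ y : A →ₐ[ℤ_[p]] ℤ_[p], HomCongr N y x ∧
      q (coords π y - coords π x) = (p : ℤ_[p]) ^ N • z := by
    intro z
    obtain ⟨v, hv, hvx, hvz⟩ := hsurj _ (pow_smul_mem_powSub N z)
    obtain ⟨y, rfl⟩ := exists_coords_eq hπ v (hzero v fun j => congrFun hv j)
    exact ⟨y, (homCongr_iff_coords hπ _ _ _).2 hvx, hvz⟩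
  choose φ hφx hφq using hφ
  -- In the ball, the coordinates `q` detect congruences exactly: `q` is integral, and the converse
  -- is the injectivity part of the chart.
  have key : ∀ y y' : A →ₐ[ℤ_[p]] ℤ_[p], HomCongr N y x → HomCongr N y' x → ∀ k,
      (HomCongr k y y' ↔ q (coords π y - coords π y') ∈ powSub p (Fin d → ℤ_[p]) k) := by
    intro y y' hy hy' k
    rw [homCongr_iff_coords hπ] at hy hy' ⊢
    exact ⟨map_mem_powSub q, hinj _ _ (hzero' y) (hzero' y') hy hy' k⟩
  have hsub : ∀ y y' : A →ₐ[ℤ_[p]] ℤ_[p], q (coords π y - coords π y') =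
      q (coords π y - coords π x) - q (coords π y' - coords π x) := fun y y' => by
    rw [← map_sub, sub_sub_sub_cancel_right]
  refine ⟨N, d, φ, ?_, fun y => ⟨fun hy => ?_, ?_⟩, fun z z' k => ?_⟩
  -- The coordinates come from elements `u i` of `A`, with value `p^N z i` at `φ z`. A polynomial
  -- relation between them over `ℚ_p` vanishes on a product of infinite sets, hence is trivial.
  · let u : Fin d → A := fun i =>
      ∑ l, algebraMap ℤ_[p] A (q (fun j => if l = j then 1 else 0) i) * (π (X l) - algebraMap _ _ (coords π x l))
    have hu : ∀ (y : A →ₐ[ℤ_[p]] ℤ_[p]) i, y (u i) = q (coords π y - coords π x) i := by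
      intro y i
      have hl := LinearMap.pi_apply_eq_sum_univ q (coords π y - coords π x)
      rw [hl]
      simp only [u, map_sum, map_mul, map_sub, AlgHom.commutes, Algebra.algebraMap_self_apply,
        Finset.sum_apply, Pi.smul_apply, smul_eq_mul, Pi.sub_apply]
      refine Finset.sum_congr rfl fun l _ => ?_
      rw [mul_comm]
      rfl
    refine le_ringKrullDim_of_injective
      (aeval fun i => (1 : ℚ_[p]) ⊗ₜ[ℤ_[p]] u i : MvPolynomial (Fin d) ℚ_[p] →ₐ[ℚ_[p]] _) ?_
    rw [injective_iff_map_eq_zero]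
    intro G hG
    refine eval_eq_zero_of_forall_eval_pow (N := N) G fun z => ?_
    let ψ : ℚ_[p] ⊗[ℤ_[p]] A →ₐ[ℚ_[p]] ℚ_[p] := Algebra.TensorProduct.lift (Algebra.ofId _ _)
      ((Algebra.ofId ℤ_[p] ℚ_[p]).comp (φ z)) (fun _ _ => Commute.all _ _)
    have h1 := congrArg ψ hG
    rw [map_zero, ← AlgHom.comp_apply, comp_aeval, aeval_eq_eval] at h1
    rw [← h1]
    congr 2
    funext i
    have h2 : ψ ((1 : ℚ_[p]) ⊗ₜ[ℤ_[p]] u i) = (φ z (u i) : ℚ_[p]) := by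
      simp [ψ]
    rw [h2, hu, hφq]
    rfl
  · have h1 : q (coords π y - coords π x) ∈ powSub p (Fin d → ℤ_[p]) N :=
      map_mem_powSub q ((homCongr_iff_coords hπ _ _ _).1 hy)
    obtain ⟨z, hz⟩ := mem_powSub.1 h1
    refine ⟨z, coords_injective hπ (sub_eq_zero.1 (eq_zero_of_forall_mem_powSub (p := p)
      fun k => ?_))⟩
    rw [← homCongr_iff_coords hπ, key _ _ (hφx z) hy, hsub, hφq, hz, sub_self]
    exact zero_mem _
  · rintro ⟨z, rfl⟩
    exact hφx z
  · rw [key _ _ (hφx z) (hφx z'), hsub, hφq, hφq, ← smul_sub]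
    exact ⟨of_pow_smul_mem_powSub, pow_smul_mem_powSub_add N⟩

end Chart

/-! ### Affine charts of a scheme over `ℤ_p` -/

section Chart

open TensorProduct

variable {p : ℕ} [Fact p.Prime] {V : Scheme.{0}} {f : V ⟶ Spec (.of ℤ_[p])}

/-- Two `ℤ_p`-valued points are congruent modulo `p ^ n` if they have the same reduction. -/
def PointCongr (n : ℕ) (x y : PadicPoint p f) : Prop := reduction p f n x = reduction p f n y

theorem PointCongr.mono {m n : ℕ} (h : m ≤ n) {x y : PadicPoint p f} (hxy : PointCongr n x y) :
    PointCongr m x y := by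
  induction n, h using Nat.le_induction with
  | base => exact hxy
  | succ n _ ih =>
    apply ih
    unfold PointCongr at hxy ⊢
    rw [← reductionStep_reduction p f n x, hxy, reductionStep_reduction]

variable {A : Type} [CommRing A] [Algebra ℤ_[p] A] (j : Spec (.of A) ⟶ V)
  (hj : j ≫ f = Spec.map (CommRingCat.ofHom (algebraMap ℤ_[p] A)))

/-- The point of `V` given by a point of an affine chart. -/
def chartPoint (y : A →ₐ[ℤ_[p]] ℤ_[p]) : PadicPoint p f :=
  ⟨Spec.map (CommRingCat.ofHom y.toRingHom) ≫ j, by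
    rw [Category.assoc, hj, ← Spec.map_comp, ← CommRingCat.ofHom_comp]
    have : y.toRingHom.comp (algebraMap ℤ_[p] A) = RingHom.id _ := RingHom.ext y.commutes
    rw [this]
    exact Spec.map_id _⟩

/-- An open immersion is a monomorphism, so reductions may be compared in the chart, where the
kernel of `ℤ_p → ℤ/p^n` is `(p^n)`. -/
theorem pointCongr_chartPoint [IsOpenImmersion j] (n : ℕ) (y y' : A →ₐ[ℤ_[p]] ℤ_[p]) :
    PointCongr n (chartPoint j hj y) (chartPoint j hj y') ↔ HomCongr n y y' := by
  unfold PointCongr reduction chartPoint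
  simp only [← Category.assoc]
  rw [cancel_mono, ← Spec.map_comp, ← Spec.map_comp, Spec.map_inj, ← CommRingCat.ofHom_comp,
    ← CommRingCat.ofHom_comp]
  constructor
  · intro h b
    have h1 : PadicInt.toZModPow n (y b) = PadicInt.toZModPow n (y' b) :=
      DFunLike.congr_fun (congrArg CommRingCat.Hom.hom h) b
    rw [← PadicInt.ker_toZModPow, RingHom.mem_ker, map_sub, h1, sub_self]
  · intro h
    congr 1
    ext b
    have h1 := h b
    rw [← PadicInt.ker_toZModPow, RingHom.mem_ker, map_sub, sub_eq_zero] at h1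
    exact h1

/-- Every point of `Spec ℤ_p` specializes to the closed point, so an open set containing the image
of the closed point contains the whole image. -/
theorem exists_chartPoint_eq [IsOpenImmersion j] (x : PadicPoint p f)
    (hx : x.1 (IsLocalRing.closedPoint ℤ_[p]) ∈ Set.range j) : ∃ y, chartPoint j hj y = x := by
  have hr : Set.range x.1 ⊆ Set.range j := by
    rintro _ ⟨z, rfl⟩
    have hz : z ⤳ (IsLocalRing.closedPoint ℤ_[p]) := IsLocalRing.specializes_closedPoint z
    exact (hz.map x.1.continuous).mem_open j.isOpenEmbedding.isOpen_range hx
  obtain ⟨φ, hφ⟩ := Spec.map_surjective (IsOpenImmersion.lift j x.1 hr)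
  have hφj : Spec.map φ ≫ j = x.1 := by rw [hφ, IsOpenImmersion.lift_fac]
  have hid : CommRingCat.ofHom (algebraMap ℤ_[p] A) ≫ φ = 𝟙 _ := by
    apply Spec.map_injective
    rw [Spec.map_comp, ← hj, ← Category.assoc, hφj, x.2, Spec.map_id]
  refine ⟨⟨φ.hom, fun r => ?_⟩, Subtype.ext hφj⟩
  exact DFunLike.congr_fun (congrArg CommRingCat.Hom.hom hid) r

theorem comap_toZModPow_eq_closedPoint (n : ℕ) (z : PrimeSpectrum (ZMod (p ^ n))) :
    PrimeSpectrum.comap (PadicInt.toZModPow n) z = IsLocalRing.closedPoint ℤ_[p] := by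
  apply PrimeSpectrum.ext
  have hp : (p : ℤ_[p]) ∈ (PrimeSpectrum.comap (PadicInt.toZModPow n) z).asIdeal := by
    rw [PrimeSpectrum.comap_asIdeal, Ideal.mem_comap]
    refine z.2.mem_of_pow_mem n ?_
    rw [← map_pow]
    have : PadicInt.toZModPow n ((p : ℤ_[p]) ^ n) = 0 := by
      rw [← RingHom.mem_ker, PadicInt.ker_toZModPow]
      exact Ideal.mem_span_singleton_self _
    rw [this]
    exact zero_mem _
  refine ((IsLocalRing.maximalIdeal.isMaximal ℤ_[p]).eq_of_le
    (PrimeSpectrum.comap (PadicInt.toZModPow n) z).2.ne_top ?_).symm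
  rw [PadicInt.maximalIdeal_eq_span_p, Ideal.span_singleton_le_iff_mem]
  exact hp

/-- For `n ≠ 0` the spectrum of `ℤ/p^n` is non-empty and maps to the closed point. For `n = 0` it is
empty and congruence carries no information. -/
theorem PointCongr.closedPoint_eq {n : ℕ} (hn : n ≠ 0) {x y : PadicPoint p f}
    (h : PointCongr n x y) :
    x.1 (IsLocalRing.closedPoint ℤ_[p]) = y.1 (IsLocalRing.closedPoint ℤ_[p]) := by
  have : Nontrivial (ZMod (p ^ n)) :=
    ZMod.nontrivial_iff.2 (Nat.one_lt_pow hn (Fact.out : p.Prime).one_lt).ne'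
  obtain ⟨z⟩ := (inferInstance : Nonempty (PrimeSpectrum (ZMod (p ^ n))))
  have h2 : Spec.map (CommRingCat.ofHom (PadicInt.toZModPow (p := p) n)) z =
    IsLocalRing.closedPoint ℤ_[p] := comap_toZModPow_eq_closedPoint n z
  have h3 : ∀ x : PadicPoint p f, reduction p f n x z = x.1 (IsLocalRing.closedPoint ℤ_[p]) :=
    fun x => (Scheme.Hom.comp_apply (Spec.map (CommRingCat.ofHom (PadicInt.toZModPow n)))
      x.1 z).trans (congrArg (fun t => x.1 t) h2)
  rw [← h3, ← h3, show reduction p f n x = _ from h]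

-- The spectrum of `ℚ_p ⊗ A`, a localization of `A`, carries the topology induced from `Spec A`,
-- hence from `V`, and maps into the generic fibre. Krull dimension does not grow along inducing
-- maps from one space to another.
include hj in
theorem ringKrullDim_tensor_le_genericDim [IsOpenImmersion j] :
    ringKrullDim (ℚ_[p] ⊗[ℤ_[p]] A) ≤ genericDim p f := by
  let B := ℚ_[p] ⊗[ℤ_[p]] A
  let i : A →+* B := (Algebra.TensorProduct.includeRight : A →ₐ[ℤ_[p]] B).toRingHom
  have hi : Topology.IsInducing (PrimeSpectrum.comap i) := by
    let : Algebra A B := Algebra.TensorProduct.rightAlgebra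
    exact PrimeSpectrum.localization_comap_isInducing B
      (Algebra.algebraMapSubmonoid A (nonZeroDivisors ℤ_[p]))
  let φ : PrimeSpectrum B → V := fun q => j (PrimeSpectrum.comap i q : PrimeSpectrum A)
  have hφ : Topology.IsInducing φ := j.isOpenEmbedding.isInducing.comp hi
  have hη : ∀ q, φ q ∈ f ⁻¹' {genericPt p} := by
    intro q
    have h1 : f (φ q) = (j ≫ f) (PrimeSpectrum.comap i q : PrimeSpectrum A) := 
      (Scheme.Hom.comp_apply j f _).symm
    rw [Set.mem_preimage, Set.mem_singleton_iff, h1, hj]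
    change PrimeSpectrum.comap (algebraMap ℤ_[p] A) (PrimeSpectrum.comap i q) = ⊥
    let P : Ideal ℚ_[p] := q.asIdeal.comap (algebraMap ℚ_[p] B)
    have hP : P = ⊥ := (Ideal.eq_bot_or_top P).resolve_right (q.2.comap _).ne_top
    apply PrimeSpectrum.ext
    rw [PrimeSpectrum.comap_asIdeal, PrimeSpectrum.comap_asIdeal, Ideal.comap_comap]
    have h2 : i.comp (algebraMap ℤ_[p] A) = (algebraMap ℚ_[p] B).comp (algebraMap ℤ_[p] ℚ_[p]) := by
      rw [← IsScalarTower.algebraMap_eq]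
      exact Algebra.TensorProduct.includeRight.comp_algebraMap
    rw [h2, ← Ideal.comap_comap]
    change P.comap _ = ⊥
    rw [hP]
    exact Ideal.comap_bot_of_injective _ (FaithfulSMul.algebraMap_injective _ _)
  let ψ : PrimeSpectrum B → f.fiber (genericPt p) :=
    (f.fiberHomeo (genericPt p)).symm ∘ Set.codRestrict φ _ hη
  have hψ : Topology.IsInducing ψ :=
    (f.fiberHomeo (genericPt p)).symm.isInducing.comp (hφ.codRestrict hη)
  rw [← PrimeSpectrum.topologicalKrullDim_eq_ringKrullDim]
  exact hψ.topologicalKrullDim_le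

-- By `hg` the basic open set of `g` maps into `U`, by an open immersion, so it inherits smoothness
-- from `U`.
include hj in
theorem formallySmooth_of_smooth [IsOpenImmersion j] {U : V.Opens} (hU : Smooth (U.ι ≫ f)) (g : A)
    (hg : ∀ z : PrimeSpectrum A, g ∉ z.asIdeal → (j : Spec (.of A) → V) z ∈ U) :
    Algebra.FormallySmooth ℤ_[p] (Localization.Away g) := by
  let i : Spec (.of (Localization.Away g)) ⟶ Spec (.of A) :=
    Spec.map (CommRingCat.ofHom (algebraMap A (Localization.Away g)))
  have hi : IsOpenImmersion i :=
    IsOpenImmersion.of_isLocalization g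
  have hr : Set.range (i ≫ j) ⊆ Set.range U.ι := by
    rintro _ ⟨z, rfl⟩
    rw [Scheme.Opens.range_ι, Scheme.Hom.comp_apply]
    refine hg _ fun hz => ?_
    exact z.2.ne_top (Ideal.eq_top_of_isUnit_mem _ hz (IsLocalization.Away.algebraMap_isUnit g))
  let l := IsOpenImmersion.lift U.ι (i ≫ j) hr
  have hl : l ≫ U.ι = i ≫ j := IsOpenImmersion.lift_fac _ _ _
  have hlo : IsOpenImmersion l := by
    have : IsOpenImmersion (l ≫ U.ι) := by rw [hl]; infer_instance
    exact IsOpenImmersion.of_comp l U.ι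
  have h1 : Smooth (l ≫ U.ι ≫ f) := inferInstance
  rw [← Category.assoc, hl, Category.assoc, hj, ← Spec.map_comp, ← CommRingCat.ofHom_comp,
    HasRingHomProperty.Spec_iff (P := @Smooth), CommRingCat.hom_ofHom,
    ← IsScalarTower.algebraMap_eq, RingHom.smooth_algebraMap] at h1
  infer_instance

end Chart

/-! ### Balls in the set of `ℤ_p`-valued points -/

section Balls

open TensorProduct

theorem isOpen_powSub {p : ℕ} [Fact p.Prime] {ι : Type*} [Finite ι] (k : ℕ) :
    IsOpen (powSub p (ι → ℤ_[p]) k : Set (ι → ℤ_[p])) := by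
  have : (powSub p (ι → ℤ_[p]) k : Set (ι → ℤ_[p])) =
      ⋂ i, {v | ‖v i‖ < (p : ℝ) ^ (-k + 1 : ℤ)} := by
    ext v
    simp only [SetLike.mem_coe, mem_powSub_iff_mem_span, Set.mem_iInter, Set.mem_ofPred_eq,
      ← PadicInt.norm_le_pow_iff_mem_span_pow, PadicInt.norm_le_pow_iff_norm_lt_pow_add_one]
  rw [this]
  exact isOpen_iInter_of_finite fun i => isOpen_lt (by fun_prop) continuous_const

variable {p : ℕ} [Fact p.Prime] {V : Scheme.{0}} {f : V ⟶ Spec (.of ℤ_[p])}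

/-- The ball of radius `p ^ (-N)` around `x` looks like `ℤ_p ^ d`. -/
def IsPadicBall (N d : ℕ) (x : PadicPoint p f) : Prop :=
  ∃ φ : (Fin d → ℤ_[p]) → PadicPoint p f,
    (∀ y, PointCongr N y x ↔ ∃ z, φ z = y) ∧
    ∀ z z' k, PointCongr (N + k) (φ z) (φ z') ↔ z - z' ∈ powSub p (Fin d → ℤ_[p]) k

/-- Recentre the chart at the parameter of `y` and rescale by `p^(M - N)`. -/
theorem IsPadicBall.of_le {M N d : ℕ} (hNM : N ≤ M) {x y : PadicPoint p f} (h : IsPadicBall N d x)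
    (hy : PointCongr N y x) : IsPadicBall M d y := by
  obtain ⟨φ, hφ, hφ'⟩ := h
  obtain ⟨a, rfl⟩ := (hφ y).1 hy
  obtain ⟨l, rfl⟩ := Nat.exists_eq_add_of_le hNM
  refine ⟨fun z => φ (a + (p : ℤ_[p]) ^ l • z), fun y => ⟨fun h => ?_, ?_⟩, fun z z' k => ?_⟩
  · obtain ⟨b, rfl⟩ := (hφ y).1 ((PointCongr.mono hNM h).trans hy)
    obtain ⟨w, hw⟩ := mem_powSub.1 ((hφ' _ _ _).1 h)
    exact ⟨w, by dsimp only; rw [hw, add_sub_cancel]⟩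
  · rintro ⟨z, rfl⟩
    rw [hφ', add_sub_cancel_left]
    exact pow_smul_mem_powSub l z
  · rw [add_assoc, hφ', add_sub_add_left_eq_sub, ← smul_sub]
    exact ⟨of_pow_smul_mem_powSub, pow_smul_mem_powSub_add l⟩

variable {A : Type} [CommRing A] [Algebra ℤ_[p] A] [Algebra.FiniteType ℤ_[p] A]
  (j : Spec (.of A) ⟶ V) [IsOpenImmersion j]
  (hj : j ≫ f = Spec.map (CommRingCat.ofHom (algebraMap ℤ_[p] A)))

theorem exists_isPadicBall_chartPoint (y : A →ₐ[ℤ_[p]] ℤ_[p])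
    (hs : SmoothAtPoint p f ((chartPoint j hj y).1 (genericPt p))) :
    ∃ N d : ℕ, (d : WithBot ℕ∞) ≤ genericDim p f ∧ IsPadicBall N d (chartPoint j hj y) := by
  obtain ⟨U, hxU, hU⟩ := hs
  let P : PrimeSpectrum A := PrimeSpectrum.comap y.toRingHom (⊥ : PrimeSpectrum ℤ_[p])
  have hP : (chartPoint j hj y).1 (genericPt p) = (j : Spec (.of A) → V) P :=
    Scheme.Hom.comp_apply (Spec.map (CommRingCat.ofHom y.toRingHom)) j (genericPt p)
  have hopen : IsOpen {z : PrimeSpectrum A | (j : Spec (.of A) → V) z ∈ U} :=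
    U.2.preimage j.continuous
  obtain ⟨_, ⟨g, rfl⟩, hPg, hg⟩ := PrimeSpectrum.isTopologicalBasis_basic_opens.exists_subset_of_mem_open
    (show P ∈ {z : PrimeSpectrum A | (j : Spec (.of A) → V) z ∈ U} by
      rw [Set.mem_ofPred_eq, ← hP]
      exact hxU) hopen
  have := formallySmooth_of_smooth j hj hU g fun z hz => hg hz
  -- Smoothness is known at the generic point only: `y g` is non-zero but may be divisible by `p`.
  have hyg : y g ≠ 0 := fun h => hPg (show y.toRingHom g ∈ (⊥ : Ideal ℤ_[p]) from h)
  obtain ⟨N, d, φ, hd, hφ, hφ'⟩ := exists_algebra_chart y g hyg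
  -- The exponent must be positive for the ball in `V` to stay inside the affine chart: congruence
  -- modulo `p` fixes the image of the closed point, congruence modulo `p^0` does not.
  refine ⟨N + 1, d, hd.trans (ringKrullDim_tensor_le_genericDim j hj), ?_⟩
  obtain ⟨a, ha⟩ := (hφ y).1 fun b => by simp
  refine ⟨fun z => chartPoint j hj (φ (a + (p : ℤ_[p]) ^ 1 • z)), fun x => ⟨fun hx => ?_, ?_⟩,
    fun z z' k => ?_⟩
  · obtain ⟨y', rfl⟩ := exists_chartPoint_eq j hj x (by
      rw [hx.closedPoint_eq (Nat.succ_ne_zero N)]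
      exact ⟨_, (Scheme.Hom.comp_apply _ j _).symm⟩)
    obtain ⟨b, rfl⟩ := (hφ y').1 ((pointCongr_chartPoint j hj _ _ _).1
      (PointCongr.mono N.le_succ hx))
    subst ha
    obtain ⟨w, hw⟩ := mem_powSub.1 ((hφ' _ _ _).1 ((pointCongr_chartPoint j hj _ _ _).1 hx))
    exact ⟨w, by dsimp only; rw [hw, add_sub_cancel]⟩
  · rintro ⟨z, rfl⟩
    subst ha
    rw [pointCongr_chartPoint, hφ', add_sub_cancel_left]
    exact pow_smul_mem_powSub 1 z
  · rw [pointCongr_chartPoint, add_assoc, hφ', add_sub_add_left_eq_sub, ← smul_sub]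
    exact ⟨of_pow_smul_mem_powSub, pow_smul_mem_powSub_add 1⟩

/-- The points of `A` form a closed, hence compact, subset of `ℤ_p^n`, and the exponent found at one
point serves its whole ball. Quantifying over all `M ≥ N` lets the property pass to finite unions.
-/
theorem exists_forall_isPadicBall_chartPoint
    (hs : ∀ x : PadicPoint p f, SmoothAtPoint p f (x.1 (genericPt p))) :
    ∃ N : ℕ, ∀ y : A →ₐ[ℤ_[p]] ℤ_[p], ∀ M, N ≤ M →
      ∃ d : ℕ, (d : WithBot ℕ∞) ≤ genericDim p f ∧ IsPadicBall M d (chartPoint j hj y) := by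
  obtain ⟨n, π, hπ⟩ := Algebra.FiniteType.iff_quotient_mvPolynomial''.1
    (inferInstance : Algebra.FiniteType ℤ_[p] A)
  have hclosed : IsClosed (Set.range (coords (p := p) π)) := by
    have : Set.range (coords (p := p) π) =
        ⋂ b ∈ RingHom.ker π, {v | MvPolynomial.eval v b = 0} := by
      ext v
      simp only [Set.mem_iInter, Set.mem_ofPred_eq]
      constructor
      · rintro ⟨y, rfl⟩ b hb
        rw [← apply_eq_eval_coords, (RingHom.mem_ker).1 hb, map_zero]
      · intro h
        exact exists_coords_eq hπ v h
    rw [this]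
    exact isClosed_biInter fun b _ => isClosed_eq b.continuous_eval continuous_const
  have key := hclosed.isCompact.induction_on
    (p := fun s => ∃ N : ℕ, ∀ y : A →ₐ[ℤ_[p]] ℤ_[p], coords π y ∈ s → ∀ M, N ≤ M →
      ∃ d : ℕ, (d : WithBot ℕ∞) ≤ genericDim p f ∧ IsPadicBall M d (chartPoint j hj y))
    ⟨0, fun y hy => hy.elim⟩
    (fun s t hst ⟨N, hN⟩ => ⟨N, fun y hy => hN y (hst hy)⟩)
    (fun s t ⟨N, hN⟩ ⟨N', hN'⟩ => ⟨max N N', fun y hy M hM => hy.elim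
      (fun h => hN y h M (le_of_max_le_left hM)) (fun h => hN' y h M (le_of_max_le_right hM))⟩)
    (by
      rintro _ ⟨x, rfl⟩
      obtain ⟨N, d, hd, hx⟩ := exists_isPadicBall_chartPoint j hj x (hs _)
      refine ⟨{v | v - coords π x ∈ powSub p (Fin n → ℤ_[p]) N}, mem_nhdsWithin_of_mem_nhds ?_,
        N, fun y hy M hM => ⟨d, hd, hx.of_le hM ?_⟩⟩
      · refine (IsOpen.preimage (f := fun v => v - coords π x) (by fun_prop)
          (isOpen_powSub N)).mem_nhds ?_
        simp
      · rw [pointCongr_chartPoint, homCongr_iff_coords hπ]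
        exact hy)
  obtain ⟨N, hN⟩ := key
  exact ⟨N, fun y => hN y ⟨y, rfl⟩⟩

/-- The reduction depends only on the coordinates modulo `p^n`. -/
theorem finite_range_reduction_chartPoint (n : ℕ) :
    (Set.range fun y : A →ₐ[ℤ_[p]] ℤ_[p] => reduction p f n (chartPoint j hj y)).Finite := by
  obtain ⟨m, π, hπ⟩ := Algebra.FiniteType.iff_quotient_mvPolynomial''.1
    (inferInstance : Algebra.FiniteType ℤ_[p] A)
  have : NeZero (p ^ n) := ⟨pow_ne_zero _ (Fact.out : p.Prime).ne_zero⟩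
  let c : (A →ₐ[ℤ_[p]] ℤ_[p]) → Fin m → ZMod (p ^ n) := fun y i =>
    PadicInt.toZModPow n (coords π y i)
  have hc : ∀ y y', c y = c y' →
      reduction p f n (chartPoint j hj y) = reduction p f n (chartPoint j hj y') := by
    intro y y' h
    refine (pointCongr_chartPoint j hj n y y').2 ((homCongr_iff_coords hπ n y y').2 ?_)
    rw [mem_powSub_iff_mem_span]
    intro i
    rw [← PadicInt.ker_toZModPow, RingHom.mem_ker, Pi.sub_apply, map_sub, sub_eq_zero]
    exact congrFun h i
  rcases isEmpty_or_nonempty (A →ₐ[ℤ_[p]] ℤ_[p]) with h0 | ⟨⟨y0⟩⟩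
  · rw [Set.range_eq_empty]
    exact Set.finite_empty
  have : Nonempty (Spec (.of (ZMod (p ^ n))) ⟶ V) := ⟨reduction p f n (chartPoint j hj y0)⟩
  obtain ⟨F, hF⟩ := (Function.factorsThrough_iff
    (f := c) (fun y : A →ₐ[ℤ_[p]] ℤ_[p] => reduction p f n (chartPoint j hj y))).1
      (fun y y' h => hc y y' h)
  rw [hF]
  exact (Set.finite_range F).subset (Set.range_comp_subset_range _ _)

end Balls

/-! ### The set of `ℤ_p`-valued points of a scheme of finite type -/

section Global

variable {p : ℕ} [Fact p.Prime] {V : Scheme.{0}} {f : V ⟶ Spec (.of ℤ_[p])}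

theorem exists_finite_affine_charts [LocallyOfFiniteType f] [QuasiCompact f] :
    ∃ (ι : Type) (_ : Finite ι) (A : ι → Type) (_ : ∀ i, CommRing (A i))
      (_ : ∀ i, Algebra ℤ_[p] (A i)) (_ : ∀ i, Algebra.FiniteType ℤ_[p] (A i))
      (j : ∀ i, Spec (.of (A i)) ⟶ V) (_ : ∀ i, IsOpenImmersion (j i)),
      (∀ i, j i ≫ f = Spec.map (CommRingCat.ofHom (algebraMap ℤ_[p] (A i)))) ∧
      ∀ v : V, ∃ i, v ∈ Set.range (j i) := by
  have : CompactSpace V := QuasiCompact.compactSpace_of_compactSpace f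
  let 𝒰 := V.affineOpenCover
  obtain ⟨t, ht⟩ := isCompact_univ.elim_finite_subcover (fun i => Set.range (𝒰.f i))
    (fun i => (𝒰.f i).isOpenEmbedding.isOpen_range)
    (fun v _ => Set.mem_iUnion.2 ⟨_, 𝒰.covers v⟩)
  let R : t → CommRingCat.{0} := fun i => 𝒰.X i.1
  let j : ∀ i, Spec (R i) ⟶ V := fun i => 𝒰.f i.1
  have hj : ∀ i, IsOpenImmersion (j i) := fun i => inferInstanceAs (IsOpenImmersion (𝒰.f i.1))
  choose φ hφ using fun i => Spec.map_surjective (j i ≫ f)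
  let alg : ∀ i, Algebra ℤ_[p] (R i) := fun i => (φ i).hom.toAlgebra
  refine ⟨t, inferInstance, fun i => R i, inferInstance, alg, fun i => ?_, j, hj,
    fun i => (hφ i).symm, fun v => ?_⟩
  · have h1 : LocallyOfFiniteType (j i ≫ f) := inferInstance
    rw [← hφ, HasRingHomProperty.Spec_iff (P := @LocallyOfFiniteType)] at h1
    exact h1
  · obtain ⟨i, hi, hv⟩ := Set.mem_iUnion₂.1 (ht (Set.mem_univ v))
    exact ⟨⟨i, hi⟩, hv⟩

theorem exists_forall_isPadicBall [LocallyOfFiniteType f] [QuasiCompact f]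
    (hs : ∀ x : PadicPoint p f, SmoothAtPoint p f (x.1 (genericPt p))) :
    ∃ N : ℕ, ∀ x : PadicPoint p f,
      ∃ d : ℕ, (d : WithBot ℕ∞) ≤ genericDim p f ∧ IsPadicBall N d x := by
  obtain ⟨ι, _, A, _, _, _, j, _, hj, hcov⟩ := exists_finite_affine_charts (f := f)
  have := Fintype.ofFinite ι
  choose N hN using fun i => exists_forall_isPadicBall_chartPoint (j i) (hj i) hs
  refine ⟨∑ i, N i, fun x => ?_⟩
  obtain ⟨i, hi⟩ := hcov (x.1 (IsLocalRing.closedPoint ℤ_[p]))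
  obtain ⟨y, rfl⟩ := exists_chartPoint_eq (j i) (hj i) x hi
  exact hN i y _ (Finset.single_le_sum (fun _ _ => Nat.zero_le _) (Finset.mem_univ i))

theorem finite_range_reduction [LocallyOfFiniteType f] [QuasiCompact f] (n : ℕ) :
    (Set.range (reduction p f n)).Finite := by
  obtain ⟨ι, _, A, _, _, _, j, _, hj, hcov⟩ := exists_finite_affine_charts (f := f)
  refine (Set.finite_iUnion fun i =>
    finite_range_reduction_chartPoint (j i) (hj i) n).subset ?_
  rintro _ ⟨x, rfl⟩
  obtain ⟨i, hi⟩ := hcov (x.1 (IsLocalRing.closedPoint ℤ_[p]))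
  obtain ⟨y, rfl⟩ := exists_chartPoint_eq (j i) (hj i) x hi
  exact Set.mem_iUnion.2 ⟨i, y, rfl⟩

end Global

/-! ### Isomorphisms of trees -/

namespace Tree

/-- Parents are unique, and depths force `w` to have a parent in `S`; so the relation in `T` has no
room for further pairs. -/
theorem isomorphic_of_bijective {S T : Tree} (e : S.Node → T.Node) (he : Function.Bijective e)
    (hd : ∀ v, T.depth (e v) = S.depth v) (hc : ∀ w v, S.IsChild w v → T.IsChild (e w) (e v)) :
    S.Isomorphic T := by
  refine ⟨Equiv.ofBijective e he, fun w v => ⟨hc w v, fun h => ?_⟩⟩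
  change T.IsChild (e w) (e v) at h
  have h1 := T.depth_of_isChild h
  rw [hd] at h1
  obtain ⟨v', hv'⟩ := S.exists_parent (w := w) (by omega)
  rwa [he.1 (T.parent_unique h (hc _ _ hv'))]

theorem Isomorphic.symm {S T : Tree} (h : S.Isomorphic T) : T.Isomorphic S := by
  obtain ⟨e, he⟩ := h
  exact ⟨e.symm, fun w v => by rw [he, e.apply_symm_apply, e.apply_symm_apply]⟩

theorem Isomorphic.trans {S T U : Tree} (h : S.Isomorphic T) (h' : T.Isomorphic U) :
    S.Isomorphic U := by
  obtain ⟨e, he⟩ := h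
  obtain ⟨e', he'⟩ := h'
  exact ⟨e.trans e', fun w v => (he w v).trans (he' _ _)⟩

/-- The tree of the nodes of depth at most `N`. -/
def trunc (T : Tree) (N : ℕ) : Tree where
  Node := {v : T.Node // T.depth v ≤ N}
  IsChild w v := T.IsChild w.1 v.1
  depth v := T.depth v.1
  depth_of_isChild h := T.depth_of_isChild h
  root_unique hv hw := Subtype.ext (T.root_unique hv hw)
  exists_parent {w} hw := by
    obtain ⟨v, hv⟩ := T.exists_parent hw
    have := T.depth_of_isChild hv
    exact ⟨⟨v, by have := w.2; omega⟩, hv⟩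
  parent_unique h h' := Subtype.ext (T.parent_unique h h')

/-- A node of depth less than `N` keeps its children in the truncation. -/
theorem depth_leaf_trunc {T : Tree} (hT : ∀ v, ∃ w, T.IsChild w v) {N : ℕ} (w : (T.trunc N).Leaf) :
    T.depth w.1.1 = N := by
  obtain ⟨v, hv⟩ := hT w.1.1
  have h1 := T.depth_of_isChild hv
  have h2 := w.1.2
  by_contra h
  exact w.2 ⟨v, by omega⟩ hv

end Tree

/-! ### Nodes of `T(ℤ_p^d)` and `T(V)` given by points -/

section Nodes

variable {p : ℕ} [Fact p.Prime]

/-- The node of `T(ℤ_p^d)` at depth `n` below the element `z` of `ℤ_p^d`. -/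
def padicNode {d : ℕ} (n : ℕ) (z : Fin d → ℤ_[p]) : (padicTree p d).Node :=
  ⟨n, fun i => PadicInt.toZModPow n (z i)⟩

theorem padicNode_eq_iff {d n m : ℕ} {z z' : Fin d → ℤ_[p]} :
    padicNode n z = padicNode m z' ↔ n = m ∧ z - z' ∈ powSub p (Fin d → ℤ_[p]) n := by
  have key : (fun i => PadicInt.toZModPow n (z i)) = (fun i => PadicInt.toZModPow n (z' i)) ↔
      z - z' ∈ powSub p (Fin d → ℤ_[p]) n := by
    simp only [funext_iff, mem_powSub_iff_mem_span, ← PadicInt.ker_toZModPow, RingHom.mem_ker,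
      Pi.sub_apply, map_sub, sub_eq_zero]
  constructor
  · intro h
    obtain rfl : n = m := congrArg Sigma.fst h
    exact ⟨rfl, key.1 (eq_of_heq (Sigma.mk.inj h).2)⟩
  · rintro ⟨rfl, h⟩
    exact congrArg (Sigma.mk n) (key.2 h)

theorem exists_eq_padicNode {d : ℕ} (b : (padicTree p d).Node) :
    ∃ z : Fin d → ℤ_[p], b = padicNode ((padicTree p d).depth b) z := by
  obtain ⟨n, a⟩ := b
  have hs : Function.Surjective (PadicInt.toZModPow (p := p) n) := ZMod.ringHom_surjective _
  choose z hz using fun i => hs (a i)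
  exact ⟨z, congrArg (Sigma.mk n) (funext fun i => (hz i).symm)⟩

theorem isChild_padicNode {d : ℕ} (n : ℕ) (z : Fin d → ℤ_[p]) :
    (padicTree p d).IsChild (padicNode (n + 1) z) (padicNode n z) := by
  refine ⟨n, _, rfl, congrArg (Sigma.mk n) (funext fun i => ?_)⟩
  exact (DFunLike.congr_fun (PadicInt.zmod_cast_comp_toZModPow n (n + 1) n.le_succ) (z i)).symm

theorem exists_of_isChild_padicTree {d : ℕ} {w v : (padicTree p d).Node}
    (h : (padicTree p d).IsChild w v) :
    ∃ (n : ℕ) (z : Fin d → ℤ_[p]), w = padicNode (n + 1) z ∧ v = padicNode n z := by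
  obtain ⟨z, hz⟩ := exists_eq_padicNode w
  rw [(padicTree p d).depth_of_isChild h] at hz
  refine ⟨_, z, hz, ?_⟩
  subst hz
  exact (padicTree p d).parent_unique h (isChild_padicNode _ z)

variable {V : Scheme.{0}} {f : V ⟶ Spec (.of ℤ_[p])}

/-- The node of `T(V)` at depth `n` below the point `x`. -/
def pointNode (n : ℕ) (x : PadicPoint p f) : (schemeTree p f).Node :=
  ⟨n, ⟨reduction p f n x, x, rfl⟩⟩

theorem pointNode_eq_iff {n m : ℕ} {x y : PadicPoint p f} :
    pointNode n x = pointNode m y ↔ n = m ∧ PointCongr n x y := by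
  constructor
  · intro h
    obtain rfl : n = m := congrArg Sigma.fst h
    exact ⟨rfl, congrArg Subtype.val (eq_of_heq (Sigma.mk.inj h).2)⟩
  · rintro ⟨rfl, h⟩
    exact congrArg (Sigma.mk n) (Subtype.ext h)

theorem exists_eq_pointNode (v : (schemeTree p f).Node) :
    ∃ x, v = pointNode ((schemeTree p f).depth v) x := by
  obtain ⟨n, _, x, rfl⟩ := v
  exact ⟨x, rfl⟩

theorem isChild_pointNode (n : ℕ) (x : PadicPoint p f) :
    (schemeTree p f).IsChild (pointNode (n + 1) x) (pointNode n x) :=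
  ⟨n, _, rfl, congrArg (Sigma.mk n) (Subtype.ext (reductionStep_reduction p f n x).symm)⟩

theorem exists_isChild_schemeTree (v : (schemeTree p f).Node) :
    ∃ w, (schemeTree p f).IsChild w v := by
  obtain ⟨x, hx⟩ := exists_eq_pointNode v
  exact ⟨_, hx ▸ isChild_pointNode _ x⟩

/-- `T(ℤ_p^d)` is the part of `T(V)` below the node of `x` at depth `N`: the node of `z` at depth
`k` goes to the node of `φ z` at depth `N + k`. The equivalence of congruences makes this
independent of `z` and injective. -/
theorem exists_branch_map {N d : ℕ} {x : PadicPoint p f} (h : IsPadicBall N d x) :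
    ∃ g : (padicTree p d).Node → (schemeTree p f).Node,
      (∀ b, (schemeTree p f).depth (g b) = N + (padicTree p d).depth b) ∧
      (∀ b c, (padicTree p d).IsChild b c → (schemeTree p f).IsChild (g b) (g c)) ∧
      (∀ b, (padicTree p d).depth b = 0 → g b = pointNode N x) ∧
      (∀ b, ∃ y, PointCongr N y x ∧ g b = pointNode (N + (padicTree p d).depth b) y) ∧
      (∀ k y, PointCongr N y x → ∃ b, (padicTree p d).depth b = k ∧ g b = pointNode (N + k) y) ∧
      Function.Injective g := by
  obtain ⟨φ, hφ, hφ'⟩ := h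
  choose z hz using exists_eq_padicNode (p := p) (d := d)
  let g : (padicTree p d).Node → (schemeTree p f).Node := fun b =>
    pointNode (N + (padicTree p d).depth b) (φ (z b))
  have hg : ∀ k a, g (padicNode k a) = pointNode (N + k) (φ a) := by
    intro k a
    refine pointNode_eq_iff.2 ⟨rfl, (hφ' _ _ _).2 ?_⟩
    exact (padicNode_eq_iff.1 (hz (padicNode k a)).symm).2
  refine ⟨g, fun b => rfl, fun b c hbc => ?_, fun b hb => ?_, fun b => ⟨_, (hφ _).2 ⟨_, rfl⟩, rfl⟩,
    fun k y hy => ?_, fun b c hbc => ?_⟩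
  · obtain ⟨n, a, rfl, rfl⟩ := exists_of_isChild_padicTree hbc
    rw [hg, hg]
    exact isChild_pointNode (N + n) (φ a)
  · rw [hz b, hb, hg]
    exact pointNode_eq_iff.2 ⟨rfl, (hφ _).2 ⟨_, rfl⟩⟩
  · obtain ⟨a, rfl⟩ := (hφ y).1 hy
    exact ⟨padicNode k a, rfl, hg k a⟩
  · obtain ⟨h1, h2⟩ := pointNode_eq_iff.1 hbc
    have h3 : (padicTree p d).depth b = (padicTree p d).depth c := by omega
    rw [hz b, hz c]
    exact padicNode_eq_iff.2 ⟨h3, (hφ' _ _ _).1 h2⟩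

theorem schemeTree_isomorphic_attachLeaves (N : ℕ) (d : ((schemeTree p f).trunc N).Leaf → ℕ)
    (x : ((schemeTree p f).trunc N).Leaf → PadicPoint p f) (hx : ∀ w, w.1.1 = pointNode N (x w))
    (hball : ∀ w, IsPadicBall N (d w) (x w)) :
    (schemeTree p f).Isomorphic
      (((schemeTree p f).trunc N).attachLeaves fun w => padicTree p (d w)) := by
  choose g hdepth hchild hroot hrep hsurj hinj using fun w => exists_branch_map (hball w)
  refine Tree.Isomorphic.symm (Tree.isomorphic_of_bijective
    (fun v => Sum.elim (fun v => v.1) (fun b => g b.1 b.2.1) v) ⟨?_, ?_⟩ ?_ ?_)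
  · rintro (v | ⟨w, b, hb⟩) (v' | ⟨w', b', hb'⟩) h
    · exact congrArg Sum.inl (Subtype.ext h)
    · have h1 := v.2
      rw [show v.1 = g w' b' from h, hdepth] at h1
      have h2 : (padicTree p (d w')).depth b' ≠ 0 := hb'
      omega
    · have h1 := v'.2
      rw [← show g w b = v'.1 from h, hdepth] at h1
      have h2 : (padicTree p (d w)).depth b ≠ 0 := hb
      omega
    · have h0 : g w b = g w' b' := h
      obtain ⟨y, hy, hgy⟩ := hrep w b
      obtain ⟨y', hy', hgy'⟩ := hrep w' b'
      have h1 := h0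
      rw [hgy, hgy', pointNode_eq_iff] at h1
      -- Equal nodes below depth `N` have the same ancestor at depth `N`, so both lie in the branch
      -- of one leaf.
      have h2 : PointCongr N y y' := h1.2.mono (Nat.le_add_right _ _)
      have h3 : w = w' := by
        refine Subtype.ext (Subtype.ext ?_)
        rw [hx, hx]
        exact pointNode_eq_iff.2 ⟨rfl, (hy.symm.trans h2).trans hy'⟩
      subst h3
      obtain rfl := hinj w h0
      rfl
  · intro v
    rcases le_or_gt ((schemeTree p f).depth v) N with h | h
    · exact ⟨.inl ⟨v, h⟩, rfl⟩
    · obtain ⟨y, hy⟩ := exists_eq_pointNode v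
      obtain ⟨k, hk⟩ := Nat.exists_eq_add_of_lt h
      rw [hk, add_assoc] at hy
      let w : ((schemeTree p f).trunc N).Leaf := ⟨⟨pointNode N y, le_rfl⟩, fun u hu => by
        have h1 : (schemeTree p f).depth u.1 = N + 1 := (schemeTree p f).depth_of_isChild hu
        have h3 := u.2
        omega⟩
      obtain ⟨b, hb, hgb⟩ := hsurj w (k + 1) y (pointNode_eq_iff.1 (hx w)).2
      exact ⟨.inr ⟨w, b, show (padicTree p (d w)).depth b ≠ 0 by omega⟩, hgb.trans hy.symm⟩
  · rintro (v | ⟨w, b, hb⟩)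
    · rfl
    · change (schemeTree p f).depth (g w b) = (schemeTree p f).depth w.1.1 + _
      rw [hdepth, Tree.depth_leaf_trunc exists_isChild_schemeTree]
  · rintro _ _ (⟨h⟩ | ⟨w, b, hb⟩ | ⟨w, b, c, hbc⟩)
    · exact h
    · change (schemeTree p f).IsChild (g w b.1) w.1.1
      obtain ⟨c, hc⟩ := (padicTree p (d w)).exists_parent b.2
      have h1 := (padicTree p (d w)).depth_of_isChild hc
      rw [hx w, ← hroot w c (by omega)]
      exact hchild w _ _ hc
    · exact hchild w _ _ hbc

theorem exists_isomorphic_attachLeaves [LocallyOfFiniteType f] [QuasiCompact f]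
    (hs : ∀ x : PadicPoint p f, SmoothAtPoint p f (x.1 (genericPt p))) :
    ∃ F : Tree, Finite F.Node ∧ ∃ d : F.Leaf → ℕ, (∀ w, (d w : WithBot ℕ∞) ≤ genericDim p f) ∧
      (schemeTree p f).Isomorphic (F.attachLeaves fun w => padicTree p (d w)) := by
  obtain ⟨N, hN⟩ := exists_forall_isPadicBall hs
  choose d hd hball using hN
  have hx : ∀ w : ((schemeTree p f).trunc N).Leaf, ∃ x, w.1.1 = pointNode N x := fun w => by
    obtain ⟨x, hx⟩ := exists_eq_pointNode w.1.1
    rw [Tree.depth_leaf_trunc exists_isChild_schemeTree] at hx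
    exact ⟨x, hx⟩
  choose x hx using hx
  refine ⟨(schemeTree p f).trunc N, ?_, fun w => d (x w), fun w => hd _,
    schemeTree_isomorphic_attachLeaves N _ x hx fun w => hball _⟩
  have := fun n => (finite_range_reduction (f := f) n).to_subtype
  let e : ((schemeTree p f).trunc N).Node → Σ n : Fin (N + 1), Set.range (reduction p f n) :=
    fun v => ⟨⟨v.1.1, Nat.lt_succ_of_le v.2⟩, v.1.2⟩
  refine Finite.of_injective e ?_
  rintro ⟨⟨n, a⟩, h⟩ ⟨⟨m, b⟩, h'⟩ heq
  obtain rfl : n = m := congrArg (fun t => t.1.1) heq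
  obtain rfl : a = b := eq_of_heq (Sigma.mk.inj heq).2
  rfl

end Nodes

/-! ### Trees attached to trees -/

namespace Tree

/-- The nodes of depth zero are those without parent, so an isomorphism preserves depths
automatically. -/
theorem Isomorphic.exists_equiv {S T : Tree} (h : S.Isomorphic T) :
    ∃ e : S.Node ≃ T.Node, (∀ w v, S.IsChild w v ↔ T.IsChild (e w) (e v)) ∧
      ∀ v, T.depth (e v) = S.depth v := by
  obtain ⟨e, he⟩ := h
  refine ⟨e, he, fun v => ?_⟩
  induction hn : S.depth v generalizing v with
  | zero =>
    by_contra h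
    obtain ⟨w, hw⟩ := T.exists_parent h
    rw [← e.apply_symm_apply w, ← he] at hw
    have := S.depth_of_isChild hw
    omega
  | succ n ih =>
    obtain ⟨w, hw⟩ := S.exists_parent (w := v) (by omega)
    have h1 := S.depth_of_isChild hw
    rw [T.depth_of_isChild ((he _ _).1 hw), ih w (by omega)]

theorem attach_congr (T : Tree) {ι : Type} (pos : ι → T.Node) {B B' : ι → Tree}
    (h : ∀ i, (B i).Isomorphic (B' i)) : (T.attach pos B).Isomorphic (T.attach pos B') := by
  choose e he hd using fun i => (h i).exists_equiv
  refine isomorphic_of_bijective (Sum.map id (Sigma.map id fun i b => ⟨e i b.1, fun h0 =>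
    b.2 ((hd i b.1).symm.trans h0)⟩)) (Function.bijective_id.sumMap ⟨?_, ?_⟩) ?_ ?_
  · refine Function.injective_id.sigma_map fun i b c hbc => ?_
    exact Subtype.ext ((e i).injective (congrArg Subtype.val hbc))
  · refine Function.surjective_id.sigma_map fun i c => ?_
    refine ⟨⟨(e i).symm c.1, ?_⟩, Subtype.ext ((e i).apply_symm_apply _)⟩
    rw [← hd, (e i).apply_symm_apply]
    exact c.2
  · rintro (v | ⟨i, b⟩)
    · rfl
    · exact congrArg (T.depth (pos i) + ·) (hd i b.1)
  · rintro _ _ (⟨h⟩ | ⟨i, b, hb⟩ | ⟨i, b, c, hbc⟩)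
    · exact .base h
    · exact .top i _ (by rw [hd]; exact hb)
    · exact .branch i _ _ ((he i _ _).1 hbc)

theorem attach_isomorphic_self (T : Tree) {ι : Type} (pos : ι → T.Node) {B : ι → Tree}
    (h : ∀ i b, (B i).depth b = 0) : T.Isomorphic (T.attach pos B) := by
  refine isomorphic_of_bijective Sum.inl ⟨Sum.inl_injective, ?_⟩ (fun _ => rfl) fun _ _ h => .base h
  rintro (v | ⟨i, b⟩)
  · exact ⟨v, rfl⟩
  · exact absurd (h i _) b.2

/-- The tree with one node. -/
def point : Tree where
  Node := Unit
  IsChild _ _ := False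
  depth _ := 0
  depth_of_isChild h := h.elim
  root_unique _ _ := rfl
  exists_parent h := absurd rfl h
  parent_unique h := h.elim

instance : Finite point.Node := inferInstanceAs (Finite Unit)

theorem exists_root (T : Tree) (h : Nonempty T.Node) : ∃ v, T.depth v = 0 := by
  obtain ⟨v⟩ := h
  induction hn : T.depth v generalizing v with
  | zero => exact ⟨v, hn⟩
  | succ n ih =>
    obtain ⟨w, hw⟩ := T.exists_parent (w := v) (by omega)
    have := T.depth_of_isChild hw
    exact ih w (by omega)

theorem attachLeaves_point_isomorphic (T : Tree) (h : Nonempty T.Node) :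
    (point.attachLeaves fun _ => T).Isomorphic T := by
  obtain ⟨r, hr⟩ := T.exists_root h
  let w0 : point.Leaf := ⟨(), fun _ h => h⟩
  refine isomorphic_of_bijective (Sum.elim (fun _ => r) fun x => x.2.1) ⟨?_, ?_⟩ ?_ ?_
  · rintro (⟨⟩ | ⟨⟨⟨⟩, w⟩, b, hb⟩) (⟨⟩ | ⟨⟨⟨⟩, w'⟩, b', hb'⟩) h
    · rfl
    · obtain rfl : r = b' := h
      exact absurd hr hb'
    · obtain rfl : b = r := h
      exact absurd hr hb
    · obtain rfl : b = b' := h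
      rfl
  · intro b
    by_cases hb : T.depth b = 0
    · exact ⟨.inl (), T.root_unique hr hb⟩
    · exact ⟨.inr ⟨w0, b, hb⟩, rfl⟩
  · rintro (⟨⟩ | ⟨w, b⟩)
    · exact hr
    · exact (Nat.zero_add _).symm
  · rintro _ _ (⟨⟨⟩⟩ | ⟨w, b, hb⟩ | ⟨w, b, c, hbc⟩)
    · change T.IsChild b.1 r
      obtain ⟨c, hc⟩ := T.exists_parent b.2
      have h1 := T.depth_of_isChild hc
      have hb' : T.depth b.1 = 1 := hb
      rwa [T.root_unique hr (w := c) (by omega)]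
    · exact hbc

theorem nonempty_prod {S T : Tree} (hS : Nonempty S.Node) (hT : Nonempty T.Node) :
    Nonempty (S.prod T).Node := by
  obtain ⟨v, hv⟩ := S.exists_root hS
  obtain ⟨w, hw⟩ := T.exists_root hT
  exact ⟨⟨(v, w), hv.trans hw.symm⟩⟩

/-- The tree obtained from `F` by adding one child to each node satisfying `E`. -/
def addChildren (F : Tree) (E : F.Node → Prop) : Tree where
  Node := F.Node ⊕ {u : F.Node // E u}
  IsChild w v := Sum.elim (fun w => Sum.elim (fun v => F.IsChild w v) (fun _ => False) v)
    (fun w => v = .inl w.1) w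
  depth := Sum.elim F.depth fun w => F.depth w.1 + 1
  depth_of_isChild {w v} h := by
    rcases w with w | w
    · rcases v with v | v
      · exact F.depth_of_isChild h
      · exact h.elim
    · obtain rfl : v = .inl w.1 := h
      rfl
  root_unique {v w} hv hw := by
    rcases v with v | v
    · rcases w with w | w
      · exact congrArg Sum.inl (F.root_unique hv hw)
      · exact absurd hw (Nat.succ_ne_zero _)
    · exact absurd hv (Nat.succ_ne_zero _)
  exists_parent {w} h := by
    rcases w with w | w
    · obtain ⟨v, hv⟩ := F.exists_parent (w := w) h
      exact ⟨.inl v, hv⟩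
    · exact ⟨.inl w.1, rfl⟩
  parent_unique {w v v'} h h' := by
    rcases w with w | w
    · rcases v with v | v
      · rcases v' with v' | v'
        · exact congrArg Sum.inl (F.parent_unique h h')
        · exact h'.elim
      · exact h.elim
    · exact h.trans h'.symm

end Tree

/-! ### The trees `T(ℤ_p^d)` -/

section Padic

variable {p : ℕ}

theorem nonempty_padicTree (d : ℕ) : Nonempty (padicTree p d).Node := ⟨⟨0, fun _ => 0⟩⟩

theorem existsUnique_depth_padicTree_zero (n : ℕ) :
    ∃! b : (padicTree p 0).Node, (padicTree p 0).depth b = n := by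
  refine ⟨⟨n, Fin.elim0⟩, rfl, ?_⟩
  rintro ⟨m, b⟩ rfl
  exact congrArg (Sigma.mk m) (Subsingleton.elim _ _)

/-- Splitting off one coordinate produces the factor `T(ℤ_p)` that side branches carry. -/
theorem padicTree_succ_isomorphic (d : ℕ) :
    (padicTree p (d + 1)).Isomorphic ((padicTree p 1).prod (padicTree p d)) := by
  refine Tree.isomorphic_of_bijective
    (fun b => ⟨(⟨b.1, fun _ => b.2 0⟩, ⟨b.1, fun i => b.2 i.succ⟩), rfl⟩) ⟨?_, ?_⟩
    (fun _ => rfl) ?_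
  · rintro ⟨n, a⟩ ⟨m, b⟩ h
    have h1 := congrArg (fun x => x.1.1) h
    have h2 := congrArg (fun x => x.1.2) h
    obtain rfl : n = m := congrArg Sigma.fst h1
    have h3 := eq_of_heq (Sigma.mk.inj h1).2
    have h4 := eq_of_heq (Sigma.mk.inj h2).2
    refine congrArg (Sigma.mk n) (funext fun i => ?_)
    refine Fin.cases ?_ (fun i => ?_) i
    · exact congrFun h3 0
    · exact congrFun h4 i
  · rintro ⟨⟨⟨n, a⟩, ⟨m, b⟩⟩, h⟩
    obtain rfl : n = m := h
    refine ⟨⟨n, Fin.cons (a 0) b⟩, Subtype.ext (Prod.ext ?_ ?_)⟩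
    · refine congrArg (Sigma.mk n) (funext fun i => ?_)
      rw [Subsingleton.elim i 0]
      rfl
    · exact congrArg (Sigma.mk n) (funext fun i => rfl)
  · rintro _ _ ⟨n, y, rfl, rfl⟩
    exact ⟨⟨n, _, rfl, rfl⟩, ⟨n, _, rfl, rfl⟩⟩

end Padic

/-! ### Level data for finite trees with trees attached to the leaves -/

section Level

variable {m : ℕ} (F : Tree) [Finite F.Node] (E : F.Node → Prop)
  (M : Set (Fin m → ℤ))

/-- The skeleton `F`, with a bone of infinite length added below each node satisfying `E`. -/
def extSkeleton : SkeletonDatum M where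
  skel := F.addChildren E
  finite := inferInstanceAs (Finite (F.Node ⊕ {u : F.Node // E u}))
  length e := Sum.elim (fun _ => ((fun _ => 1 : M → ℕ) : WithTop (M → ℕ))) (fun _ => ⊤) e.lower
  linear e ℓ h := by
    rcases hl : e.lower with u | u
    · rw [hl] at h
      obtain rfl := WithTop.coe_injective h
      exact ⟨0, 1, by simp⟩
    · rw [hl] at h
      exact absurd h.symm (WithTop.coe_ne_top)
  pos e ℓ h κ := by
    rcases hl : e.lower with u | u
    · rw [hl] at h
      obtain rfl := WithTop.coe_injective h
      exact one_pos
    · rw [hl] at h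
      exact absurd h.symm (WithTop.coe_ne_top)
  leaf_of_length e h := by
    rcases hl : e.lower with u | u
    · rw [hl] at h
      exact absurd h (WithTop.coe_ne_top)
    · rintro (w | w) hw
      · exact hw
      · exact absurd hw Sum.inr_ne_inl

/-- A side branch not depending on the parameter, with only one tree attached to the node. -/
def constBranch (S : Tree) (hS : Nonempty S.Node) : SideBranchDatum M where
  fin := Tree.point
  finite := inferInstance
  nonempty := ⟨()⟩
  side _ _ := S
  side_nonempty _ _ := hS

variable (S : F.Node → Tree) (hS : ∀ u, Nonempty (S u).Node)

/-- The level datum with skeleton `extSkeleton F E M`, with the tree `T(ℤ_p) × S u` attached to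
each node `u` of `F`. -/
def extLevelDatum : LevelDatum M where
  ρ := 1
  ρ_pos := one_pos
  skeleton := extSkeleton F E M
  length_mod _ _ _ _ _ := Nat.modEq_one
  jointBranch v := Sum.elim (fun u => constBranch M (S u) (hS u))
    (fun _ => constBranch M Tree.point ⟨()⟩) v.1
  boneBranch _ _ := constBranch _ Tree.point ⟨()⟩

/-- The tree attached to a node by `extLevelDatum` is the product of `T(ℤ_p)` and this tree. -/
def extSide (κ : M) : (extSkeleton F E M).TreeNode κ → Tree :=
  Sum.elim (fun v => Sum.elim S (fun _ => Tree.point) v.1) fun _ => Tree.point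

theorem extLevelDatum_tree_isomorphic (p : ℕ) (κ : M) :
    ((extLevelDatum F E M S hS).tree p κ).Isomorphic
      (((extSkeleton F E M).tree κ).attach (fun v : (extSkeleton F E M).TreeNode κ => v)
        fun v => (padicTree p 1).prod (extSide F E M S κ v)) := by
  refine Tree.attach_congr _ _ ?_
  rintro (⟨u | u, hu⟩ | b)
  · exact Tree.attachLeaves_point_isomorphic _ (Tree.nonempty_prod (nonempty_padicTree 1) (hS u))
  · exact Tree.attachLeaves_point_isomorphic _
      (Tree.nonempty_prod (nonempty_padicTree 1) ⟨()⟩)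
  · exact Tree.attachLeaves_point_isomorphic _
      (Tree.nonempty_prod (nonempty_padicTree 1) ⟨()⟩)

theorem SkeletonDatum.jointDepth_of_depth_eq_zero {m : ℕ} {M : Set (Fin m → ℤ)}
    (D : SkeletonDatum M) (κ : M) (v : D.skel.Node) (h : D.skel.depth v = 0) :
    D.jointDepth κ v = 0 := by
  rw [jointDepth, dif_pos h]

theorem not_isVirtual_inl (u : F.Node) : ¬ (extSkeleton F E M).IsVirtual (.inl u) := by
  rintro ⟨e, he, h⟩
  have h1 : Sum.elim (fun _ => ((fun _ => 1 : M → ℕ) : WithTop (M → ℕ))) (fun _ => ⊤) e.lower =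
    (⊤ : WithTop (M → ℕ)) := h
  rw [he] at h1
  exact WithTop.coe_ne_top h1

variable {F E}

/-- The bone of infinite length below a node satisfying `E`. -/
def infEdge (u : F.Node) (hu : E u) : (F.addChildren E).Edge := ⟨.inl u, .inr ⟨u, hu⟩, rfl⟩

variable {M}

theorem lengthAt_infEdge (κ : M) (u : F.Node) (hu : E u) :
    (extSkeleton F E M).lengthAt κ (infEdge u hu) = ⊤ := rfl

theorem isVirtual_inr (u : {u : F.Node // E u}) : (extSkeleton F E M).IsVirtual (.inr u) :=
  ⟨infEdge u.1 u.2, rfl, rfl⟩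

theorem lengthAt_eq_one (κ : M) (e : (F.addChildren E).Edge) (u : F.Node) (h : e.lower = .inl u) :
    (extSkeleton F E M).lengthAt κ e = 1 := by
  change (Sum.elim (fun _ => ((fun _ => 1 : M → ℕ) : WithTop (M → ℕ))) (fun _ => ⊤) e.lower).map
    (fun ℓ => ℓ κ) = (1 : ℕ∞)
  rw [h]
  rfl

theorem jointDepth_inl (κ : M) (u : F.Node) :
    (extSkeleton F E M).jointDepth κ (.inl u) = F.depth u := by
  induction hn : F.depth u generalizing u with
  | zero =>
    exact (extSkeleton F E M).jointDepth_of_depth_eq_zero κ (.inl u) hn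
  | succ n ih =>
    obtain ⟨v, hv⟩ := F.exists_parent (w := u) (by omega)
    have h1 := F.depth_of_isChild hv
    let e : (F.addChildren E).Edge := ⟨.inl v, .inl u, hv⟩
    have h2 := (extSkeleton F E M).jointDepth_lower κ e
    have h3 : (extSkeleton F E M).jointDepth κ (.inl u) = _ := h2
    rw [h3, lengthAt_eq_one κ e u rfl, show (extSkeleton F E M).jointDepth κ e.upper = _ from
      ih v (by omega)]
    push_cast
    rfl

variable {p : ℕ}

/-- At a leaf in `E` the tree `K w` is an infinite path, and its node of depth `i` becomes the inner
node at distance `i` on the infinite bone. At the other leaves `K w` becomes the side branch. All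
other nodes receive `T(ℤ_p)` times a point, which has only a root and adds nothing. -/
theorem attachLeaves_isomorphic_ext (hE : ∀ u, E u → F.IsLeaf u) (κ : M) (K : F.Leaf → Tree)
    (hK : ∀ w : F.Leaf, E w.1 → ∀ n, ∃! b : (K w).Node, (K w).depth b = n)
    (hK' : ∀ w : F.Leaf, ¬ E w.1 → (K w).Isomorphic ((padicTree p 1).prod (S w.1)))
    (hS' : ∀ u, (F.IsLeaf u → E u) → S u = Tree.point) :
    (F.attachLeaves K).Isomorphic
      (((extSkeleton F E M).tree κ).attach (fun v : (extSkeleton F E M).TreeNode κ => v)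
        fun v => (padicTree p 1).prod (extSide F E M S κ v)) := by
  classical
  choose φ hφ hφd using fun w h => (hK' w h).exists_equiv
  let r : F.Node → (extSkeleton F E M).TreeNode κ := fun u =>
    .inl ⟨.inl u, not_isVirtual_inl F E M u⟩
  have hr : ∀ u, (extSkeleton F E M).nodeDepth κ (r u) = F.depth u := fun u => by
    change ((extSkeleton F E M).jointDepth κ (.inl u)).toNat = _
    rw [jointDepth_inl, ENat.toNat_natCast]
  let bone : ∀ u, E u → ∀ i : ℕ, 0 < i → (extSkeleton F E M).TreeNode κ := fun u hu i hi =>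
    .inr ⟨infEdge u hu, i, hi, by rw [lengthAt_infEdge]; exact ENat.natCast_lt_top i⟩
  let ψ : (Σ w : F.Leaf, {b : (K w).Node // (K w).depth b ≠ 0}) →
      (((extSkeleton F E M).tree κ).attach (fun v : (extSkeleton F E M).TreeNode κ => v)
        fun v => (padicTree p 1).prod (extSide F E M S κ v)).Node := fun x =>
    if h : E x.1.1 then .inl (bone x.1.1 h ((K x.1).depth x.2.1) (Nat.pos_of_ne_zero x.2.2))
    else .inr ⟨r x.1.1, φ x.1 h x.2.1, by
      have := hφd x.1 h x.2.1
      exact fun h0 => x.2.2 (this.symm.trans h0)⟩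
  have hψ : ∀ w (h : E w.1) b, ψ ⟨w, b⟩ =
      .inl (bone w.1 h ((K w).depth b.1) (Nat.pos_of_ne_zero b.2)) := fun w h b => dif_pos h
  have hψ' : ∀ w (h : ¬ E w.1) b, ψ ⟨w, b⟩ = .inr ⟨r w.1, φ w h b.1, by
      have := hφd w h b.1
      exact fun h0 => b.2 (this.symm.trans h0)⟩ := fun w h b => dif_neg h
  have hr_inj : ∀ u u', r u = r u' → u = u' := fun u u' h =>
    Sum.inl_injective (congrArg Subtype.val (Sum.inl_injective h))
  have hbone : ∀ u hu i hi u' hu' i' hi', bone u hu i hi = bone u' hu' i' hi' →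
      u = u' ∧ i = i' := by
    intro u hu i hi u' hu' i' hi' h
    have h1 := Sum.inr_injective h
    exact ⟨Sum.inl_injective (congrArg (fun x => x.1.upper) h1), congrArg (fun x => x.2.1) h1⟩
  have hbone_child : ∀ u hu i hi j hj, j = i + 1 → ((extSkeleton F E M).tree κ).IsChild
      (bone u hu j hj) (bone u hu i hi) := fun u hu i hi j hj h =>
    ⟨infEdge u hu, i, ⟨rfl, rfl⟩, ⟨rfl, h⟩⟩
  have hbone_top : ∀ u hu j hj, j = 1 → ((extSkeleton F E M).tree κ).IsChild
      (bone u hu j hj) (r u) := fun u hu j hj h =>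
    ⟨infEdge u hu, 0, .inl ⟨rfl, rfl⟩, ⟨rfl, h⟩⟩
  have hr_child : ∀ w v, F.IsChild w v → ((extSkeleton F E M).tree κ).IsChild (r w) (r v) :=
    fun w v h => ⟨⟨.inl v, .inl w, h⟩, 0, .inl ⟨rfl, rfl⟩, .inr ⟨rfl,
      Nat.cast_one.trans (lengthAt_eq_one κ _ w rfl).symm⟩⟩
  refine Tree.isomorphic_of_bijective (Sum.elim (fun u => Sum.inl (r u)) ψ) ⟨?_, ?_⟩ ?_ ?_
  · rintro (u | ⟨w, b⟩) (u' | ⟨w', b'⟩) h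
    · exact congrArg Sum.inl (hr_inj _ _ (Sum.inl_injective h))
    · have h0 : Sum.inl (r u) = ψ ⟨w', b'⟩ := h
      by_cases hw : E w'.1
      · rw [hψ _ hw] at h0
        exact absurd (Sum.inl_injective h0) Sum.inl_ne_inr
      · rw [hψ' _ hw] at h0
        exact absurd h0 Sum.inl_ne_inr
    · have h0 : Sum.inl (r u') = ψ ⟨w, b⟩ := h.symm
      by_cases hw : E w.1
      · rw [hψ _ hw] at h0
        exact absurd (Sum.inl_injective h0) Sum.inl_ne_inr
      · rw [hψ' _ hw] at h0
        exact absurd h0 Sum.inl_ne_inr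
    · have h0 : ψ ⟨w, b⟩ = ψ ⟨w', b'⟩ := h
      by_cases hw : E w.1 <;> by_cases hw' : E w'.1
      · rw [hψ _ hw, hψ _ hw'] at h0
        obtain ⟨h1, h2⟩ := hbone _ hw _ (Nat.pos_of_ne_zero b.2) _ hw' _
          (Nat.pos_of_ne_zero b'.2) (Sum.inl_injective h0)
        obtain rfl : w = w' := Subtype.ext h1
        obtain rfl : b = b' := Subtype.ext ((hK w hw _).unique h2 rfl)
        rfl
      · rw [hψ _ hw, hψ' _ hw'] at h0
        exact absurd h0 Sum.inl_ne_inr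
      · rw [hψ' _ hw, hψ _ hw'] at h0
        exact absurd h0.symm Sum.inl_ne_inr
      · rw [hψ' _ hw, hψ' _ hw'] at h0
        have h1 := Sum.inr_injective h0
        obtain rfl : w = w' := Subtype.ext (hr_inj _ _ (congrArg Sigma.fst h1))
        have h2 := congrArg Subtype.val (eq_of_heq (Sigma.mk.inj h1).2)
        obtain rfl : b = b' := Subtype.ext ((φ w hw).injective h2)
        rfl
  · rintro ((⟨u | u, hu⟩ | ⟨e, i, hi, hi'⟩) | ⟨⟨u | u, hu⟩ | e, b, hb⟩)
    · exact ⟨.inl u, rfl⟩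
    · exact absurd (isVirtual_inr u) hu
    -- Bones of `F` have length one, hence no inner nodes; only infinite bones contribute.
    · rcases hl : e.lower with u | u
      · rw [lengthAt_eq_one κ e u hl] at hi'
        have : i < 1 := by exact_mod_cast hi'
        omega
      · have he : e = infEdge u.1 u.2 := Tree.edge_eq _ hl
        subst he
        let w : F.Leaf := ⟨u.1, hE _ u.2⟩
        obtain ⟨b, hb, -⟩ := hK w u.2 i
        refine ⟨.inr ⟨w, b, hb.trans_ne hi.ne'⟩, ?_⟩
        subst hb
        exact hψ w u.2 _
    · by_cases h : F.IsLeaf u ∧ ¬ E u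
      · let w : F.Leaf := ⟨u, h.1⟩
        have hb' : φ w h.2 ((φ w h.2).symm b) = b := (φ w h.2).apply_symm_apply b
        refine ⟨.inr ⟨w, (φ w h.2).symm b, fun h0 => hb ?_⟩, ?_⟩
        · have h1 := hφd w h.2 ((φ w h.2).symm b)
          rw [hb', h0] at h1
          exact h1
        · refine (hψ' w h.2 _).trans (congrArg Sum.inr (congrArg (Sigma.mk (r u)) ?_))
          exact Subtype.ext hb'
      · have hSu : S u = Tree.point := hS' u fun hu => by tauto
        refine absurd (b.2.trans ?_) hb
        have : ∀ c : (S u).Node, (S u).depth c = 0 := by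
          rw [hSu]
          exact fun c => rfl
        exact this _
    · exact absurd (isVirtual_inr u) hu
    · exact absurd b.2 hb
  · rintro (u | ⟨w, b⟩)
    · exact hr u
    · change Tree.depth _ (ψ ⟨w, b⟩) = F.depth w.1 + (K w).depth b.1
      by_cases hw : E w.1
      · rw [hψ _ hw]
        change ((extSkeleton F E M).jointDepth κ (.inl w.1)).toNat + _ = _
        rw [jointDepth_inl, ENat.toNat_natCast]
      · rw [hψ' _ hw]
        exact congrArg₂ (· + ·) (hr w.1) (hφd w hw b.1)
  · rintro _ _ (⟨h⟩ | ⟨w, b, hb⟩ | ⟨w, b, c, hbc⟩)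
    · exact .base (hr_child _ _ h)
    · change Tree.AttachChild _ _ _ (ψ ⟨w, b⟩) (.inl (r w.1))
      by_cases hw : E w.1
      · rw [hψ _ hw]
        exact .base (hbone_top w.1 hw _ (Nat.pos_of_ne_zero b.2) hb)
      · rw [hψ' _ hw]
        exact .top _ _ ((hφd w hw b.1).trans hb)
    · change Tree.AttachChild _ _ _ (ψ ⟨w, b⟩) (ψ ⟨w, c⟩)
      by_cases hw : E w.1
      · rw [hψ _ hw, hψ _ hw]
        exact .base (hbone_child w.1 hw _ (Nat.pos_of_ne_zero c.2) _ (Nat.pos_of_ne_zero b.2) ((K w).depth_of_isChild hbc))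
      · rw [hψ' _ hw, hψ' _ hw]
        exact .branch _ _ _ ((hφ w hw _ _).1 hbc)

end Level

/-! ### Definability of the parameter sets -/

section Definable

open FirstOrder

/-- The language `(0, +, ≤)` of ordered groups. -/
abbrev presburgerOrder : Language := Language.sum Language.presburger Language.order

theorem definableSet_univ {m : ℕ} : DefinableSet (Set.univ : Set (Fin m → ℤ)) :=
  Set.definable_univ

theorem definableSet_le (a b : presburgerOrder[[(Set.univ : Set ℤ)]].Term
    (Fin 1)) : DefinableSet {x : Fin 1 → ℤ | a.realize x ≤ b.realize x} := by
  let R : presburgerOrder.Relations 2 :=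
    (Language.LHom.sumInr : Language.order →ᴸ presburgerOrder).onRelation
      Language.leSymb
  let R' : presburgerOrder[[(Set.univ : Set ℤ)]].Relations 2 :=
    (Language.lhomWithConstants _ (Set.univ : Set ℤ)).onRelation R
  refine ⟨R'.formula₂ a b, ?_⟩
  ext x
  simp only [Set.mem_ofPred_eq, Language.Formula.realize_rel₂]
  rfl

/-- The constant term with a given value. -/
def constTerm (k : ℤ) :
    presburgerOrder[[(Set.univ : Set ℤ)]].Term (Fin 1) :=
  Language.Constants.term
    (presburgerOrder.con (⟨k, trivial⟩ : (Set.univ : Set ℤ)))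

theorem realize_constTerm (k : ℤ) (x : Fin 1 → ℤ) : (constTerm k).realize x = k := by
  simp [constTerm]

theorem definableSet_ge (k : ℤ) : DefinableSet {x : Fin 1 → ℤ | k ≤ x 0} := by
  simpa only [realize_constTerm, Language.Term.realize_var] using definableSet_le (constTerm k) (Language.Term.var 0)

theorem definableSet_le_const (k : ℤ) : DefinableSet {x : Fin 1 → ℤ | x 0 ≤ k} := by
  simpa only [realize_constTerm, Language.Term.realize_var] using definableSet_le (Language.Term.var 0) (constTerm k)

/-- Modulo `1` the congruence condition is empty, and over a one-point parameter set the depths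
inside a bone form an interval of integers, unbounded above if the lower end has depth `∞`. -/
theorem definableSet_boneParams (D : SkeletonDatum (Set.univ : Set (Fin 0 → ℤ)))
    (e : D.skel.Edge) (c : ZMod 1) : DefinableSet (D.boneParams e 1 c) := by
  let κ : (Set.univ : Set (Fin 0 → ℤ)) := ⟨0, trivial⟩
  obtain ⟨k, hk⟩ := ENat.ne_top_iff_exists.1
    (D.jointDepth_ne_top κ e.upper (D.not_isVirtual_upper e))
  have hκ : ∀ κ', κ' = κ := fun κ' => Subtype.ext (Subsingleton.elim _ _)
  have hmem : ∀ x : Fin 1 → ℤ, x ∈ D.boneParams e 1 c ↔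
      ∃ n : ℕ, x 0 = n ∧ k < n ∧ (n : ℕ∞) < D.jointDepth κ e.lower := by
    intro x
    constructor
    · rintro ⟨h, n, hn, -, h1, h2⟩
      rw [hκ ⟨_, h⟩] at h1 h2
      rw [← hk] at h1
      exact ⟨n, hn, by exact_mod_cast h1, h2⟩
    · rintro ⟨n, hn, h1, h2⟩
      have h0 : Fin.init x ∈ (Set.univ : Set (Fin 0 → ℤ)) := trivial
      refine ⟨h0, n, hn, Subsingleton.elim _ _, ?_, ?_⟩
      · rw [hκ ⟨_, h0⟩, ← hk]
        exact_mod_cast h1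
      · rw [hκ ⟨_, h0⟩]
        exact h2
  rcases eq_or_ne (D.jointDepth κ e.lower) ⊤ with htop | htop
  · suffices h : D.boneParams e 1 c = {x | (k : ℤ) + 1 ≤ x 0} from h ▸ definableSet_ge _
    ext x
    rw [hmem, htop]
    constructor
    · rintro ⟨n, hn, h1, -⟩
      rw [Set.mem_ofPred_eq, hn]
      omega
    · intro h
      rw [Set.mem_ofPred_eq] at h
      exact ⟨(x 0).toNat, by omega, by omega, ENat.natCast_lt_top _⟩
  · obtain ⟨l, hl⟩ := ENat.ne_top_iff_exists.1 htop
    suffices h : D.boneParams e 1 c = {x | (k : ℤ) + 1 ≤ x 0} ∩ {x | x 0 ≤ (l : ℤ) - 1} from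
      h ▸ (definableSet_ge _).inter (definableSet_le_const _)
    ext x
    rw [hmem, ← hl, Set.mem_inter_iff, Set.mem_ofPred_eq, Set.mem_ofPred_eq]
    constructor
    · rintro ⟨n, hn, h1, h2⟩
      have h2' : n < l := by exact_mod_cast h2
      omega
    · intro h
      refine ⟨(x 0).toNat, by omega, by omega, ?_⟩
      have : (x 0).toNat < l := by omega
      exact_mod_cast this

end Definable

/-! ### Levels -/

section Level

variable {p : ℕ}

theorem IsLevel.of_isomorphic {d m : ℕ} {M : Set (Fin m → ℤ)} {T T' : M → Tree}
    (h : IsLevel p d M T) (hT : ∀ κ, (T' κ).Isomorphic (T κ)) : IsLevel p d M T' := by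
  cases d with
  | zero =>
    obtain ⟨h0, D, hD⟩ := h
    exact ⟨h0, D, fun κ => (hT κ).trans (hD κ)⟩
  | succ d =>
    obtain ⟨h0, D, h1, h2, hD⟩ := h
    exact ⟨h0, D, h1, h2, fun κ => (hT κ).trans (hD κ)⟩

theorem isLevel_zero_ext {m : ℕ} {M : Set (Fin m → ℤ)} (hM : DefinableSet M) (F : Tree)
    [Finite F.Node] (E : F.Node → Prop) (hE : ∀ u, E u → F.IsLeaf u) (K : F.Leaf → Tree)
    (hK : ∀ w : F.Leaf, E w.1 → ∀ n, ∃! b : (K w).Node, (K w).depth b = n)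
    (hK' : ∀ w : F.Leaf, ¬ E w.1 → (K w).Isomorphic ((padicTree p 1).prod Tree.point)) :
    IsLevel p 0 M (fun _ => F.attachLeaves K) := by
  refine ⟨hM, extSkeleton F E M, fun κ => ?_⟩
  refine (attachLeaves_isomorphic_ext (fun _ => Tree.point) hE κ K hK hK' fun _ _ => rfl).trans
    (Tree.attach_isomorphic_self _ _ ?_).symm
  rintro (⟨u | u, hu⟩ | b) c
  · exact c.2
  · exact c.2
  · exact c.2

theorem isLevel_succ_ext {m n : ℕ} {M : Set (Fin m → ℤ)} (hM : DefinableSet M) (F : Tree)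
    [Finite F.Node] (E : F.Node → Prop) (hE : ∀ u, E u → F.IsLeaf u)
    (hpoint : IsLevel p n M fun _ => Tree.point)
    (hbone : ∀ e c, IsLevel p n ((extSkeleton F E M).boneParams e 1 c) fun _ => Tree.point)
    (S : F.Node → Tree) (hS : ∀ u, Nonempty (S u).Node) (hSn : ∀ u, IsLevel p n M fun _ => S u)
    (hS' : ∀ u, (F.IsLeaf u → E u) → S u = Tree.point) (K : F.Leaf → Tree)
    (hK : ∀ w : F.Leaf, E w.1 → ∀ n, ∃! b : (K w).Node, (K w).depth b = n)
    (hK' : ∀ w : F.Leaf, ¬ E w.1 → (K w).Isomorphic ((padicTree p 1).prod (S w.1))) :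
    IsLevel p (n + 1) M (fun _ => F.attachLeaves K) := by
  refine ⟨hM, extLevelDatum F E M S hS, ?_, fun e c w => hbone e c, fun κ => ?_⟩
  · rintro ⟨u | u, hu⟩ w
    · exact hSn u
    · exact hpoint
  · exact (attachLeaves_isomorphic_ext S hE κ K hK hK' hS').trans
      (extLevelDatum_tree_isomorphic F E M S hS p κ).symm

/-- A level datum demands a side branch at every node, so trivial branches must have every level
too. The recursion uses a skeleton with a single joint. -/
theorem isLevel_point (n : ℕ) {m : ℕ} {M : Set (Fin m → ℤ)} (hM : DefinableSet M) :
    IsLevel p n M fun _ => Tree.point := by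
  have hK : Tree.Isomorphic ((padicTree p 1).prod Tree.point) ((padicTree p 1).prod Tree.point) :=
    ⟨Equiv.refl _, fun _ _ => Iff.rfl⟩
  have hiso : Tree.point.Isomorphic
      (Tree.point.attachLeaves fun _ => (padicTree p 1).prod Tree.point) :=
    Tree.attach_isomorphic_self _ _ fun _ b => b.2
  cases n with
  | zero =>
    exact (isLevel_zero_ext hM Tree.point (fun _ => False) (fun _ h => h.elim) _
      (fun _ h => h.elim) fun _ _ => hK).of_isomorphic fun _ => hiso
  | succ n =>
    refine (isLevel_succ_ext hM Tree.point (fun _ => False) (fun _ h => h.elim)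
      (isLevel_point n hM) ?_ (fun _ => Tree.point) (fun _ => ⟨()⟩) (fun _ => isLevel_point n hM)
      (fun _ _ => rfl) _ (fun _ h => h.elim) fun _ _ => hK).of_isomorphic fun _ => hiso
    -- This skeleton has no bones.
    rintro ⟨v | v, u | u, h⟩ c
    · exact h.elim
    · exact u.2.elim
    · exact h.elim
    · exact u.2.elim

/-- A finite tree with trees `T(ℤ_p^d)` with `d ≤ n` attached to its leaves is of level `n`. -/
theorem isLevelTree_attachLeaves (n : ℕ) (F : Tree) [Finite F.Node] (d : F.Leaf → ℕ)
    (hd : ∀ w, d w ≤ n) : IsLevelTree p n (F.attachLeaves fun w => padicTree p (d w)) := by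
  classical
  induction n generalizing F with
  | zero =>
    -- Here every `d w` is zero, so an infinite bone goes below each leaf.
    refine isLevel_zero_ext definableSet_univ F F.IsLeaf (fun _ h => h) _ (fun w _ => ?_)
      fun w h => absurd w.2 h
    rw [Nat.le_zero.1 (hd w)]
    exact existsUnique_depth_padicTree_zero
  | succ n ih =>
    -- A leaf with `d w ≥ 1` carries `T(ℤ_p) × T(ℤ_p^(d w - 1))`, and `S` records the second factor.
    -- That factor has level `n` by induction, viewed as attached to the one-node tree.
    let S : F.Node → Tree := fun u =>
      if h : ∃ h : F.IsLeaf u, d ⟨u, h⟩ ≠ 0 then padicTree p (d ⟨u, h.1⟩ - 1) else Tree.point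
    have hS : ∀ u, S u = Tree.point ∨ ∃ e ≤ n, S u = padicTree p e := by
      intro u
      by_cases h : ∃ h : F.IsLeaf u, d ⟨u, h⟩ ≠ 0
      · exact .inr ⟨_, Nat.sub_le_of_le_add (hd _), dif_pos h⟩
      · exact .inl (dif_neg h)
    refine isLevel_succ_ext definableSet_univ F (fun u => ∃ h : F.IsLeaf u, d ⟨u, h⟩ = 0)
      (fun u h => h.1) (isLevel_point n definableSet_univ)
      (fun e c => isLevel_point n (definableSet_boneParams _ e c)) S (fun u => ?_) (fun u => ?_)
      (fun u hu => dif_neg ?_) _ (fun w hw => ?_) fun w hw => ?_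
    · rcases hS u with h | ⟨e, -, h⟩
      · rw [h]
        exact ⟨()⟩
      · rw [h]
        exact nonempty_padicTree e
    · rcases hS u with h | ⟨e, he, h⟩
      · rw [h]
        exact isLevel_point n definableSet_univ
      · rw [h]
        exact (ih Tree.point (fun _ => e) fun _ => he).of_isomorphic fun _ =>
          (Tree.attachLeaves_point_isomorphic _ (nonempty_padicTree e)).symm
    · rintro ⟨h, h'⟩
      exact h' (hu h).2
    · rw [show d w = 0 from hw.2]
      exact existsUnique_depth_padicTree_zero
    · have hw' : d w ≠ 0 := fun h => hw ⟨w.2, h⟩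
      have hSw : S w.1 = padicTree p (d w - 1) := dif_pos ⟨w.2, hw'⟩
      rw [hSw]
      have := padicTree_succ_isomorphic (p := p) (d w - 1)
      rwa [Nat.sub_add_cancel (Nat.pos_of_ne_zero hw')] at this

end Level

end PadicTrees

end

theorem mainTheorem4 (p : ℕ) [Fact p.Prime] (V : Scheme.{0}) (f : V ⟶ Spec (.of ℤ_[p]))
    [LocallyOfFiniteType f] [QuasiCompact f]
    (hsmooth : ∀ x : PadicTrees.PadicPoint p f,
      PadicTrees.SmoothAtPoint p f (x.1 (PadicTrees.genericPt p))) :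
    (∃ F : PadicTrees.Tree, Finite F.Node ∧ ∃ d : F.Leaf → ℕ,
      (∀ w, (d w : WithBot ℕ∞) ≤ PadicTrees.genericDim p f) ∧
      (PadicTrees.schemeTree p f).Isomorphic
        (F.attachLeaves (fun w => PadicTrees.padicTree p (d w)))) ∧
    (∀ n : ℕ, PadicTrees.genericDim p f ≤ (n : WithBot ℕ∞) →
      PadicTrees.IsLevelTree p n (PadicTrees.schemeTree p f)) := by
  have h := PadicTrees.exists_isomorphic_attachLeaves hsmooth
  refine ⟨h, fun n hn => ?_⟩
  obtain ⟨F, _, d, hd, hF⟩ := h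
  exact (PadicTrees.isLevelTree_attachLeaves n F d fun w => by
    exact_mod_cast (hd w).trans hn).of_isomorphic fun _ => hF
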